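/- **Setting.** Let $H(x,\xi)=\tfrac12|\xi|^2+\tfrac12|x|^2$ on $T^*\mathbb{R}^2=\mathbb{R}^2\times\mathbb{R}^2$, fix an energy $E>0$, and for $N=0,1,2,\dots$ let $\hbar=\hbar_N=E/(N+1)$, so that $E=\hbar(N+1)$. Let $\gamma_0(t)=\sqrt E(\cos t,\sin t,-\sin t,\cos t)$ and $$\varphi_N^{\gamma_0}(x_1,x_2)=\frac{(N+1)^{\frac{N+1}{2}}}{E^{\frac{N+1}{2}}\sqrt{\pi N!}}\,(x_1+ix_2)^N e^{-\frac{N+1}{2E}|x|^2}.$$ Let $\mathrm{SU}(2)$ act on $T^*\mathbb{R}^2\cong\mathbb{C}^2$ through $z=x+i\xi$. For $w=(x_0,\xi_0)\in T^*\mathbb{R}^2$ let $\rho_\hbar(w)$ be the phase space translation $(\rho_\hbar(w)f)(x)=e^{\frac{i}{\hbar}(\langle \xi_0,x\rangle-\frac12\langle\xi_0,x_0\rangle)}f(x-x_0)$ on $L^2(\mathbb{R}^2)$, and for $U\in\mathrm{SU}(2)$ let $\mu(U)$ be the metaplectic operator over $U$, i.e. the unitary operator on $L^2(\mathbb{R}^2)$,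 unique up to a phase factor, with $\mu(U)\rho_\hbar(w)\mu(U)^{-1}=\rho_\hbar(Uw)$ for all $w$. For a Hamiltonian orbit $\gamma$ (a solution of $x'=\xi$, $\xi'=-x$) of energy $H(\gamma)=E$, the orbital coherent state $\varphi_N^\gamma$ is defined, up to a phase factor, by $\varphi_N^\gamma=\mu(U)\varphi_N^{\gamma_0}$, where $U\in \mathrm{SU}(2)$ carries the orbit $\gamma_0$ onto the orbit $\gamma$. Its Wigner distribution is $$W_{\varphi_N^\gamma,\varphi_N^\gamma}(x,\xi)=\frac1{4\pi^2\hbar^2}\int_{\mathbb{R}^2}\varphi_N^\gamma(x+\tfrac v2)\,\overline{\varphi_N^\gamma(x-\tfrac v2)}\,e^{-\frac i\hbar\langle v,\xi\rangle}\,dv,$$ and the Weyl quantization of a symbol $a$ is $$(\operatorname{Op}^w_N(a)f)(x)=\frac1{(2\pi\hbar)^2}\int_{\mathbb{R}^2}\int_{\mathbb{R}^2}a\big(\tfrac{x+y}2,\xi\big)e^{\frac i\hbar\langle x-y,\xi\rangle}f(y)\,dy\,d\xi .$$ **Proposition 1.1.** Let $a:T^*\mathbb{R}^2\to\mathbb{R}$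 be a smooth function with exponential decay, i.e. $|a(x,\xi)|\le Ce^{-c(|x|+|\xi|)}$ for some $C$ and some $c>0$, and let $\gamma$ be a Hamiltonian orbit of energy $E$. Then, for every choice of the phase factors, $a\,W_{\varphi_N^\gamma,\varphi_N^\gamma}$ is integrable for every $N$, and as $N\to\infty$ with $E=\hbar(N+1)$ fixed, $$\int_{T^*\mathbb{R}^2}a(x,\xi)\,W_{\varphi_N^\gamma,\varphi_N^\gamma}(x,\xi)\,dx\,d\xi\longrightarrow\frac1{2\pi}\int_0^{2\pi}a(\gamma(t))\,dt .$$ Likewise $\operatorname{Op}^w_N(a)\varphi_N^\gamma\in L^2(\mathbb{R}^2)$ for every $N$, and $$\big\langle\varphi_N^\gamma,\operatorname{Op}^w_N(a)\varphi_N^\gamma\big\rangle=\int_{\mathbb{R}^2}\overline{\varphi_N^\gamma(x)}\,(\operatorname{Op}^w_N(a)\varphi_N^\gamma)(x)\,dx\longrightarrow\frac1{2\pi}\int_0^{2\pi}a(\gamma(t))\,dt .$$ -/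

import Mathlib

open MeasureTheory Filter Topology
open scoped ContDiff

noncomputable section

namespace OrbitalCoherent

/-- The configuration plane `ℝ²` with its Euclidean norm. -/
abbrev Plane := EuclideanSpace ℝ (Fin 2)

/-- The phase space `T*ℝ² = ℝ² × ℝ²`; a point is a pair `(x, ξ)`. -/
abbrev PhaseSpace := Plane × Plane

/-- The Hilbert space `L²(ℝ²; ℂ)`. -/
abbrev L2Plane := Lp ℂ 2 (volume : Measure Plane)

/-! ### Classical mechanics -/

/-- The isotropic harmonic oscillator `H(x, ξ) = |ξ|²/2 + |x|²/2`. -/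
def hamiltonian (w : PhaseSpace) : ℝ := ‖w.2‖ ^ 2 / 2 + ‖w.1‖ ^ 2 / 2

/-- Solutions of Hamilton's equations `x' = ∂H/∂ξ = ξ`, `ξ' = -∂H/∂x = -x`. -/
def IsHamiltonianOrbit (γ : ℝ → PhaseSpace) : Prop :=
  ∀ t : ℝ, HasDerivAt γ ((γ t).2, -(γ t).1) t

/-- The reference orbit `γ₀(t) = √E (cos t, sin t, -sin t, cos t)`. -/
def referenceOrbit (E t : ℝ) : PhaseSpace :=
  (!₂[√E * Real.cos t, √E * Real.sin t], !₂[-(√E * Real.sin t), √E * Real.cos t])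

/-- The action of a complex `2 × 2` matrix on `T*ℝ²`, identified with `ℂ²` by `z = x + i ξ`. -/
def matrixAct (U : Matrix (Fin 2) (Fin 2) ℂ) (w : PhaseSpace) : PhaseSpace :=
  (WithLp.toLp 2 fun j => (∑ k, U j k * ((w.1 k : ℂ) + Complex.I * (w.2 k : ℂ))).re,
   WithLp.toLp 2 fun j => (∑ k, U j k * ((w.1 k : ℂ) + Complex.I * (w.2 k : ℂ))).im)

/-! ### The metaplectic representation -/

/-- The (semiclassical) Schrödinger representation of the Heisenberg group, i.e. the phase space
translation by `w = (x₀, ξ₀)`: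
`(ρ(w) f)(x) = exp ((i/ħ) (⟨ξ₀, x⟩ - ⟨ξ₀, x₀⟩ / 2)) f(x - x₀)`. -/
def heisenbergFun (ħ : ℝ) (w : PhaseSpace) (f : Plane → ℂ) (x : Plane) : ℂ :=
  Complex.exp (((inner ℝ w.2 x - inner ℝ w.2 w.1 / 2) / ħ : ℝ) * Complex.I) * f (x - w.1)

theorem memLp_heisenbergFun (ħ : ℝ) (w : PhaseSpace) (f : L2Plane) :
    MemLp (heisenbergFun ħ w f) 2 (volume : Measure Plane) := by
  have h1 : MemLp (fun x => f (x - w.1)) 2 (volume : Measure Plane) :=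
    (Lp.memLp f).comp_measurePreserving (measurePreserving_sub_right volume w.1)
  refine h1.of_le ?_ (Eventually.of_forall fun x => ?_)
  · refine AEStronglyMeasurable.mul ?_ h1.1
    exact Continuous.aestronglyMeasurable (by fun_prop)
  · simp only [heisenbergFun]
    rw [norm_mul, Complex.norm_exp_ofReal_mul_I, one_mul]

/-- The phase space translation `ρ(w)` on `L²(ℝ²)`. -/
def heisenberg (ħ : ℝ) (w : PhaseSpace) (f : L2Plane) : L2Plane :=
  (memLp_heisenbergFun ħ w f).toLp

/-- `T` is a metaplectic operator `μ(A)` over the linear symplectic map `A`: the unitary operator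
on `L²(ℝ²)`, determined up to a phase factor, with `T ρ(w) T⁻¹ = ρ(A w)` for all `w`. -/
def IsMetaplectic (ħ : ℝ) (A : PhaseSpace → PhaseSpace) (T : L2Plane ≃ₗᵢ[ℂ] L2Plane) : Prop :=
  ∀ (w : PhaseSpace) (f : L2Plane), T (heisenberg ħ w f) = heisenberg ħ (A w) (T f)

/-! ### Orbital coherent states -/

/-- Planck's constant at energy level `N`, where `E = ħ (N + 1)`. -/
def planck (E : ℝ) (N : ℕ) : ℝ := E / (N + 1)

/-- The orbital coherent state of the reference orbit,
`(N+1)^((N+1)/2) / (E^((N+1)/2) √(π N!)) (x₁ + i x₂)^N exp (-(N+1) |x|² / (2E))`. -/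
def referenceStateFun (E : ℝ) (N : ℕ) (x : Plane) : ℂ :=
  (((N + 1 : ℝ) ^ ((N + 1 : ℝ) / 2) /
      (E ^ ((N + 1 : ℝ) / 2) * √(Real.pi * (N.factorial : ℝ))) : ℝ) : ℂ) *
    ((x 0 : ℂ) + Complex.I * (x 1 : ℂ)) ^ N *
    ((Real.exp (-((N + 1 : ℝ) / (2 * E)) * ‖x‖ ^ 2) : ℝ) : ℂ)

theorem memLp_referenceStateFun {E : ℝ} (hE : 0 < E) (N : ℕ) :
    MemLp (referenceStateFun E N) 2 (volume : Measure Plane) := by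
  have hcont : Continuous (referenceStateFun E N) := by
    unfold referenceStateFun
    fun_prop
  rw [memLp_two_iff_integrable_sq_norm hcont.aestronglyMeasurable]
  set b : ℝ := (N + 1 : ℝ) / (2 * E) with hb
  have hbpos : 0 < b := by positivity
  set C : ℝ := (N + 1 : ℝ) ^ ((N + 1 : ℝ) / 2) /
      (E ^ ((N + 1 : ℝ) / 2) * √(Real.pi * (N.factorial : ℝ))) with hC
  have hg : Integrable (fun x : Plane => Real.exp (-b * ‖x‖ ^ 2)) := by
    have h := (GaussianFourier.integrable_cexp_neg_mul_sq_norm_add (V := Plane) (b := (b : ℂ))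
      (by simpa using hbpos) 0 0).norm
    refine h.congr (Eventually.of_forall fun x => ?_)
    simp [Complex.norm_exp, ← Complex.ofReal_pow]
  refine (hg.const_mul (C ^ 2 * ((N.factorial : ℝ) / b ^ N))).mono'
    (by fun_prop) (Eventually.of_forall fun x => ?_)
  have hz : ‖(x 0 : ℂ) + Complex.I * (x 1 : ℂ)‖ ^ 2 = ‖x‖ ^ 2 := by
    rw [mul_comm, Complex.sq_norm, Complex.normSq_add_mul_I, EuclideanSpace.norm_sq_eq]
    simp
  have hp : (‖x‖ ^ 2) ^ N ≤ (N.factorial : ℝ) / b ^ N * Real.exp (b * ‖x‖ ^ 2) := by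
    have h := Real.pow_div_factorial_le_exp (b * ‖x‖ ^ 2) (by positivity) N
    rw [div_le_iff₀ (by positivity), mul_pow] at h
    rw [div_mul_eq_mul_div, le_div_iff₀ (by positivity)]
    linarith
  have he : Real.exp (-b * ‖x‖ ^ 2) ^ 2 * Real.exp (b * ‖x‖ ^ 2) = Real.exp (-b * ‖x‖ ^ 2) := by
    rw [← Real.exp_nat_mul, ← Real.exp_add]
    congr 1
    push_cast
    ring
  have hval : ‖referenceStateFun E N x‖ ^ 2
      = C ^ 2 * (‖x‖ ^ 2) ^ N * Real.exp (-b * ‖x‖ ^ 2) ^ 2 := by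
    rw [referenceStateFun, norm_mul, norm_mul, norm_pow, Complex.norm_real, Complex.norm_real,
      mul_pow, mul_pow, ← pow_mul, mul_comm N 2, pow_mul, hz, Real.norm_eq_abs, Real.norm_eq_abs,
      sq_abs, sq_abs]
  rw [Real.norm_eq_abs, abs_of_nonneg (by positivity), hval]
  calc C ^ 2 * (‖x‖ ^ 2) ^ N * Real.exp (-b * ‖x‖ ^ 2) ^ 2
      ≤ C ^ 2 * ((N.factorial : ℝ) / b ^ N * Real.exp (b * ‖x‖ ^ 2)) *
          Real.exp (-b * ‖x‖ ^ 2) ^ 2 := by gcongr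
    _ = C ^ 2 * ((N.factorial : ℝ) / b ^ N) *
          (Real.exp (-b * ‖x‖ ^ 2) ^ 2 * Real.exp (b * ‖x‖ ^ 2)) := by ring
    _ = C ^ 2 * ((N.factorial : ℝ) / b ^ N) * Real.exp (-b * ‖x‖ ^ 2) := by rw [he]

/-- The coherent state of the reference orbit as an element of `L²(ℝ²)`. -/
def referenceState {E : ℝ} (hE : 0 < E) (N : ℕ) : L2Plane :=
  (memLp_referenceStateFun hE N).toLp

/-- `φ` is the orbital coherent state `μ(U) φ_N^{γ₀}` of the orbit `γ`, where `U ∈ SU(2)` carries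
the reference orbit onto `γ` (as an orbit, that is as a set). It is unique up to a phase factor,
and every choice of the phase is admitted. -/
def IsOrbitalCoherentState {E : ℝ} (hE : 0 < E) (γ : ℝ → PhaseSpace) (N : ℕ)
    (φ : L2Plane) : Prop :=
  ∃ U ∈ Matrix.specialUnitaryGroup (Fin 2) ℂ,
    matrixAct U '' Set.range (referenceOrbit E) = Set.range γ ∧
    ∃ T : L2Plane ≃ₗᵢ[ℂ] L2Plane,
      IsMetaplectic (planck E N) (matrixAct U) T ∧ φ = T (referenceState hE N)

/-! ### Wigner distribution and Weyl quantization -/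

/-- The Wigner distribution
`W(x, ξ) = (4 π² ħ²)⁻¹ ∫ φ(x + v/2) conj(φ(x - v/2)) exp (-(i/ħ) ⟨v, ξ⟩) dv`. -/
def wigner (ħ : ℝ) (φ : Plane → ℂ) (w : PhaseSpace) : ℂ :=
  ((1 / (4 * Real.pi ^ 2 * ħ ^ 2) : ℝ) : ℂ) *
    ∫ v : Plane, φ (w.1 + (1 / 2 : ℝ) • v) * starRingEnd ℂ (φ (w.1 - (1 / 2 : ℝ) • v)) *
      Complex.exp (-((inner ℝ v w.2 / ħ : ℝ) : ℂ) * Complex.I)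

/-- The Weyl quantization of the symbol `a`,
`(Op(a) f)(x) = (2 π ħ)⁻² ∫∫ a((x + y)/2, ξ) exp ((i/ħ) ⟨x - y, ξ⟩) f(y) dy dξ`. -/
def weylOp (ħ : ℝ) (a : PhaseSpace → ℝ) (f : Plane → ℂ) (x : Plane) : ℂ :=
  ((1 / (2 * Real.pi * ħ) ^ 2 : ℝ) : ℂ) *
    ∫ p : Plane × Plane, (a ((1 / 2 : ℝ) • (x + p.1), p.2) : ℂ) *
      Complex.exp (((inner ℝ (x - p.1) p.2 / ħ : ℝ) : ℂ) * Complex.I) * f p.1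

/-- Exponential decay: `|a(x, ξ)| ≤ C exp (-c (|x| + |ξ|))` for some `C` and some `c > 0`. -/
def HasExponentialDecay (a : PhaseSpace → ℝ) : Prop :=
  ∃ C c : ℝ, 0 < c ∧ ∀ w : PhaseSpace, |a w| ≤ C * Real.exp (-c * (‖w.1‖ + ‖w.2‖))

end OrbitalCoherent

end

/-! The proof works on the Fourier side of phase space. The characteristic function `wignerChar` of
a Wigner distribution is an ambiguity function, that is, a matrix coefficient of the Heisenberg
translations. For the reference state it is a Gaussian moment with a closed form
(`gaussMoment_eq_sum`, `wignerChar_referenceStateFun`): at u = (η, y) it equals exp(-π²ħ|u|²) times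
the Laguerre polynomial L_N evaluated at π²E|ζ|²/(N+1), where ζ is `cplx y + i cplx η`. As N → ∞ the
Gaussian tends to 1, and the Mehler–Heine limit (`tendsto_laguerre_div`) turns the Laguerre factor
into J₀(2π√E|ζ|). This is exactly the Fourier transform of the uniform measure on the reference
orbit (`integral_wave_referenceOrbit`).

The characteristic functions are bounded by ‖φ‖² = 1, so Parseval (`integral_schwartz_mul_wigner`)
and dominated convergence give the limit for Schwartz symbols. To reach an integrable smooth symbol,
it is cut off near the orbit. The remainder is controlled by a pointwise bound on the Wigner
function, of order ħ⁻² 5^N exp(-|w|²/(2ħ)), which tends to 0 uniformly for |w|² ≥ 4E because 5 < e²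
(`exists_wigner_referenceStateFun_tail`).

A general orbit is reduced to the reference one by metaplectic covariance. The intertwining relation
makes characteristic functions covariant (`wignerChar_metaplectic`), hence the Wigner distributions
almost everywhere (`wigner_metaplectic_ae`). The matrix chosen may change with N, but two choices
differ by a stabilizer of the reference orbit, under which the reference Wigner function is
invariant (`wigner_referenceStateFun_matrixAct`).

The Weyl statement needs no second limit: ⟨φ, Op(a)φ⟩ is the integral of a against the Wigner
distribution (`integral_conj_mul_weylOp`). Square integrability of Op(a)φ is a Schur-type kernel
estimate (`memLp_weylOp`). -/

noncomputable section

namespace OrbitalCoherent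

/-! ### Gaussian moments on the plane. -/

/-- The complex coordinate `x₁ + i x₂` of a point of the plane. -/
def cplx (x : Plane) : ℂ := (x 0 : ℂ) + Complex.I * (x 1 : ℂ)

theorem cplx_add (x y : Plane) : cplx (x + y) = cplx x + cplx y := by
  simp [cplx]; ring

theorem cplx_smul (r : ℝ) (x : Plane) : cplx (r • x) = r * cplx x := by
  simp [cplx]; ring

theorem cplx_sub (x y : Plane) : cplx (x - y) = cplx x - cplx y := by
  simp [cplx]; ring

theorem norm_cplx_sq (x : Plane) : ‖cplx x‖ ^ 2 = ‖x‖ ^ 2 := by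
  rw [cplx, mul_comm, Complex.sq_norm, Complex.normSq_add_mul_I, EuclideanSpace.norm_sq_eq]
  simp

theorem norm_cplx (x : Plane) : ‖cplx x‖ = ‖x‖ := by
  have h := norm_cplx_sq x
  rwa [sq_eq_sq₀ (norm_nonneg _) (norm_nonneg _)] at h

theorem continuous_cplx : Continuous cplx := by
  unfold cplx; fun_prop

/-- A function of polynomial growth is integrable against a Gaussian. -/
theorem integrable_of_le_pow_mul_gaussian {b : ℝ} (hb : 0 < b) (n : ℕ) (C : ℝ) {f : Plane → ℂ}
    (hf : Continuous f)
    (hle : ∀ x, ‖f x‖ ≤ C * (1 + ‖x‖) ^ n * Real.exp (-b * ‖x‖ ^ 2)) : Integrable f := by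
  have hg : Integrable (fun x : Plane => Real.exp (-(b / 2) * ‖x‖ ^ 2)) := by
    have h := (GaussianFourier.integrable_cexp_neg_mul_sq_norm_add (V := Plane)
      (b := ((b / 2 : ℝ) : ℂ)) (by rw [Complex.ofReal_re]; positivity) 0 0).norm
    refine h.congr (Eventually.of_forall fun x => ?_)
    simp [Complex.norm_exp, ← Complex.ofReal_pow, -Complex.ofReal_ofNat, -Complex.ofReal_div]
  set K : ℝ := 2 ^ n * ((n.factorial : ℝ) / (b / 2) ^ n) * Real.exp (b / 2)
  refine (hg.const_mul (|C| * K)).mono' hf.aestronglyMeasurable (Eventually.of_forall fun x => ?_)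
  refine (hle x).trans ?_
  -- The polynomial is paid for with half of the Gaussian: (1+r)² ≤ 4(1+r²)², and yⁿ/n! ≤ e^y at y =
  -- (b/2)(1+r²).
  have h1 : (1 + ‖x‖) ^ n ≤ K * Real.exp (b / 2 * ‖x‖ ^ 2) := by
    have h2 : (1 + ‖x‖) ^ n ≤ (2 * (1 + ‖x‖ ^ 2)) ^ n := by
      gcongr
      nlinarith [sq_nonneg (‖x‖ - 1), sq_nonneg ‖x‖]
    have h3 := Real.pow_div_factorial_le_exp (b / 2 * (1 + ‖x‖ ^ 2)) (by positivity) n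
    rw [div_le_iff₀ (by positivity), mul_pow, mul_add, Real.exp_add, mul_one] at h3
    rw [mul_pow] at h2
    refine h2.trans ?_
    simp only [K]
    have h4 : (1 + ‖x‖ ^ 2) ^ n ≤ (n.factorial : ℝ) / (b / 2) ^ n *
        (Real.exp (b / 2) * Real.exp (b / 2 * ‖x‖ ^ 2)) := by
      rw [div_mul_eq_mul_div, le_div_iff₀ (by positivity)]
      linarith
    calc (2:ℝ) ^ n * (1 + ‖x‖ ^ 2) ^ n ≤ 2 ^ n * ((n.factorial : ℝ) / (b / 2) ^ n *
            (Real.exp (b / 2) * Real.exp (b / 2 * ‖x‖ ^ 2))) := by gcongr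
      _ = _ := by ring
  calc C * (1 + ‖x‖) ^ n * Real.exp (-b * ‖x‖ ^ 2)
      ≤ |C| * (K * Real.exp (b / 2 * ‖x‖ ^ 2)) * Real.exp (-b * ‖x‖ ^ 2) := by
        gcongr
        exact le_abs_self C
    _ = |C| * K * (Real.exp (b / 2 * ‖x‖ ^ 2) * Real.exp (-b * ‖x‖ ^ 2)) := by ring
    _ = _ := by rw [← Real.exp_add]; congr 2; ring

/-- The integral over the plane of a directional derivative vanishes. -/
theorem integral_lineDeriv_eq_zero {h h' : Plane → ℂ} {v : Plane} (hh : Integrable h)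
    (hh' : Integrable h') (hd : ∀ x, HasLineDerivAt ℝ h (h' x) x v) : ∫ x, h' x = 0 := by
  have := integral_bilinear_hasLineDerivAt_right_eq_neg_left_of_integrable (μ := volume)
    (f := fun _ : Plane => (1 : ℂ)) (f' := fun _ => 0) (g := h) (g' := h') (v := v)
    (B := ContinuousLinearMap.mul ℝ ℂ) (by simp) (by simpa using hh') (by simpa using hh)
    (fun x _ => by simpa using (hasFDerivAt_const (𝕜 := ℝ) (1 : ℂ) x).hasLineDerivAt v) (fun x _ => hd x)
  simpa using this

/-- The complex Gaussian `exp (-b|x|² + i⟨q, x⟩)`. -/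
def gaussWave (b : ℝ) (q x : Plane) : ℂ :=
  Complex.exp (-(b : ℂ) * (‖x‖ : ℂ) ^ 2 + Complex.I * (inner ℝ q x : ℝ))

theorem norm_gaussWave (b : ℝ) (q x : Plane) :
    ‖gaussWave b q x‖ = Real.exp (-b * ‖x‖ ^ 2) := by
  rw [gaussWave, Complex.norm_exp]
  congr 1
  simp [← Complex.ofReal_pow]

theorem continuous_gaussWave (b : ℝ) (q : Plane) : Continuous (gaussWave b q) := by
  unfold gaussWave; fun_prop

theorem integral_gaussWave {b : ℝ} (hb : 0 < b) (q : Plane) :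
    ∫ x, gaussWave b q x = (Real.pi / b * Real.exp (-‖q‖ ^ 2 / (4 * b)) : ℝ) := by
  have := GaussianFourier.integral_cexp_neg_mul_sq_norm_add (V := Plane) (b := (b : ℂ))
    (by simpa using hb) Complex.I q
  simp only [gaussWave]
  rw [this]
  have hb' : (b : ℂ) ≠ 0 := by exact_mod_cast hb.ne'
  simp [neg_div]

/-- The polynomial factor of the Gaussian moments. -/
def monom (s t : ℂ) (j k : ℕ) (x : Plane) : ℂ :=
  (starRingEnd ℂ (cplx x) + s) ^ j * (cplx x + t) ^ k

theorem integrable_mul_gaussWave {b : ℝ} (hb : 0 < b) (q : Plane) (s t : ℂ) (j k : ℕ) :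
    Integrable (fun x => monom s t j k x * gaussWave b q x) := by
  refine integrable_of_le_pow_mul_gaussian hb (j + k) ((1 + ‖s‖) ^ j * (1 + ‖t‖) ^ k) ?_ ?_
  · have := continuous_cplx
    have := continuous_gaussWave b q
    unfold monom
    fun_prop
  · intro x
    rw [norm_mul, norm_gaussWave, monom, norm_mul, norm_pow, norm_pow]
    have h1 : ‖starRingEnd ℂ (cplx x) + s‖ ≤ (1 + ‖s‖) * (1 + ‖x‖) := by
      refine (norm_add_le _ _).trans ?_
      rw [RCLike.norm_conj, norm_cplx]
      nlinarith [norm_nonneg s, norm_nonneg x, mul_nonneg (norm_nonneg s) (norm_nonneg x)]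
    have h2 : ‖cplx x + t‖ ≤ (1 + ‖t‖) * (1 + ‖x‖) := by
      refine (norm_add_le _ _).trans ?_
      rw [norm_cplx]
      nlinarith [norm_nonneg t, norm_nonneg x, mul_nonneg (norm_nonneg t) (norm_nonneg x)]
    refine mul_le_mul_of_nonneg_right ?_ (Real.exp_pos _).le
    calc _ ≤ ((1 + ‖s‖) * (1 + ‖x‖)) ^ j * ((1 + ‖t‖) * (1 + ‖x‖)) ^ k := by gcongr
      _ = _ := by rw [mul_pow, mul_pow, pow_add]; ring

/-- The Gaussian moment `∫ (ζ̄ + s)^j (ζ + t)^k exp (-b|x|² + i⟨q, x⟩) dx`. -/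
def gaussMoment (b : ℝ) (q : Plane) (s t : ℂ) (j k : ℕ) : ℂ :=
  ∫ x, monom s t j k x * gaussWave b q x

theorem hasLineDerivAt_monom_mul_gaussWave (b : ℝ) (q : Plane) (s t : ℂ) (j k : ℕ)
    (x v : Plane) :
    HasLineDerivAt ℝ (fun x => monom s t j k x * gaussWave b q x)
      ((j * starRingEnd ℂ (cplx v) * monom s t (j - 1) k x +
        k * cplx v * monom s t j (k - 1) x +
        (-2 * b * (inner ℝ x v : ℝ) + Complex.I * (inner ℝ q v : ℝ)) * monom s t j k x) *
        gaussWave b q x) x v := by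
  unfold HasLineDerivAt
  have hz : HasDerivAt (fun r : ℝ => cplx (x + r • v)) (cplx v) 0 := by
    simp only [cplx_add, cplx_smul]
    simpa using ((Complex.ofRealCLM.hasDerivAt (x := (0:ℝ))).mul_const (cplx v)).const_add (cplx x)
  have hzb : HasDerivAt (fun r : ℝ => starRingEnd ℂ (cplx (x + r • v)))
      (starRingEnd ℂ (cplx v)) 0 := by
    simp only [cplx_add, cplx_smul, map_add, map_mul, Complex.conj_ofReal]
    simpa using ((Complex.ofRealCLM.hasDerivAt (x := (0:ℝ))).mul_const
      (starRingEnd ℂ (cplx v))).const_add (starRingEnd ℂ (cplx x))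
  have hl : HasDerivAt (fun r : ℝ => x + r • v) v 0 := by
    simpa using ((hasDerivAt_id (0:ℝ)).smul_const v).const_add x
  have hn : HasDerivAt (fun r : ℝ => ‖x + r • v‖ ^ 2) (2 * inner ℝ x v) 0 := by
    simpa using hl.norm_sq
  have hi : HasDerivAt (fun r : ℝ => (inner ℝ q (x + r • v) : ℝ)) (inner ℝ q v) 0 := by
    simpa using (hasDerivAt_const (0:ℝ) q).inner ℝ hl
  have hg : HasDerivAt (fun r : ℝ => gaussWave b q (x + r • v))
      ((-2 * b * (inner ℝ x v : ℝ) + Complex.I * (inner ℝ q v : ℝ)) * gaussWave b q x) 0 := by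
    have h := (((hn.ofReal_comp).const_mul (-(b:ℂ))).add
      ((hi.ofReal_comp).const_mul Complex.I)).cexp
    simp only [gaussWave]
    convert! h using 1
    · ext r; simp
    · simp; ring
  have hm := (((hzb.add_const s).pow j).mul ((hz.add_const t).pow k)).mul hg
  convert! hm using 1
  simp [monom]
  ring

/-- Source of all moment recurrences. Writing ⟨x, v⟩ through ζ and its conjugate shows that the
derivative of a moment integrand is again a combination of such integrands, hence integrable, so its
integral vanishes. -/
theorem gaussMoment_lineDeriv {b : ℝ} (hb : 0 < b) (q : Plane) (s t : ℂ) (j k : ℕ) (v : Plane) :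
    ∫ x, ((j * starRingEnd ℂ (cplx v) * monom s t (j - 1) k x +
        k * cplx v * monom s t j (k - 1) x +
        (-2 * b * (inner ℝ x v : ℝ) + Complex.I * (inner ℝ q v : ℝ)) * monom s t j k x) *
        gaussWave b q x) = 0 ∧
    Integrable (fun x => ((j * starRingEnd ℂ (cplx v) * monom s t (j - 1) k x +
        k * cplx v * monom s t j (k - 1) x +
        (-2 * b * (inner ℝ x v : ℝ) + Complex.I * (inner ℝ q v : ℝ)) * monom s t j k x) *
        gaussWave b q x)) := by
  have hint : Integrable (fun x => ((j * starRingEnd ℂ (cplx v) * monom s t (j - 1) k x +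
        k * cplx v * monom s t j (k - 1) x +
        (-2 * b * (inner ℝ x v : ℝ) + Complex.I * (inner ℝ q v : ℝ)) * monom s t j k x) *
        gaussWave b q x)) := by
    have e : ∀ x : Plane, ((inner ℝ x v : ℝ) : ℂ) =
        (cplx v * starRingEnd ℂ (cplx x) + starRingEnd ℂ (cplx v) * cplx x) / 2 := by
      intro x
      apply Complex.ext <;> simp [cplx, PiLp.inner_apply, Fin.sum_univ_two] <;> ring
    have h1 := (integrable_mul_gaussWave hb q s t (j - 1) k).const_mul
      (j * starRingEnd ℂ (cplx v))
    have h2 := (integrable_mul_gaussWave hb q s t j (k - 1)).const_mul (k * cplx v)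
    have h3 := (integrable_mul_gaussWave hb q s t (j + 1) k).const_mul (-b * cplx v)
    have h4 := (integrable_mul_gaussWave hb q s t j (k + 1)).const_mul
      (-b * starRingEnd ℂ (cplx v))
    have h5 := (integrable_mul_gaussWave hb q s t j k).const_mul
      (Complex.I * (inner ℝ q v : ℝ) + b * cplx v * s + b * starRingEnd ℂ (cplx v) * t)
    refine ((((h1.add h2).add h3).add h4).add h5).congr (Eventually.of_forall fun x => ?_)
    simp only [Pi.add_apply, e x]
    simp only [monom, pow_succ]
    ring
  exact ⟨integral_lineDeriv_eq_zero (integrable_mul_gaussWave hb q s t j k) hint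
    (hasLineDerivAt_monom_mul_gaussWave b q s t j k · v), hint⟩

/-- Integration by parts with ∂₁ - i∂₂ = 2∂_ζ. This operator annihilates the conjugate factor,
lowers k by one, and produces -2bζ̄ from the Gaussian, which raises j. -/
theorem gaussMoment_succ_left {b : ℝ} (hb : 0 < b) (q : Plane) (s t : ℂ) (j k : ℕ) :
    gaussMoment b q s t (j + 1) k =
      k / b * gaussMoment b q s t j (k - 1) +
        (s + Complex.I * starRingEnd ℂ (cplx q) / (2 * b)) * gaussMoment b q s t j k := by
  obtain ⟨h0, i0⟩ := gaussMoment_lineDeriv hb q s t j k (EuclideanSpace.single 0 1)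
  obtain ⟨h1, i1⟩ := gaussMoment_lineDeriv hb q s t j k (EuclideanSpace.single 1 1)
  have hs := integral_sub i0 (i1.const_mul Complex.I)
  rw [integral_const_mul, h0, h1] at hs
  have hb' : (b : ℂ) ≠ 0 := by exact_mod_cast hb.ne'
  have e1 := (integrable_mul_gaussWave hb q s t j (k - 1)).const_mul ((2 * k : ℂ))
  have e2 := (integrable_mul_gaussWave hb q s t j k).const_mul
    (2 * b * s + Complex.I * starRingEnd ℂ (cplx q))
  have e3 := (integrable_mul_gaussWave hb q s t (j + 1) k).const_mul (2 * b : ℂ)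
  have hfin : (2 * k : ℂ) * gaussMoment b q s t j (k - 1) +
      (2 * b * s + Complex.I * starRingEnd ℂ (cplx q)) * gaussMoment b q s t j k -
      2 * b * gaussMoment b q s t (j + 1) k = 0 := by
    have e4 := integral_sub (e1.add e2) e3
    simp only [Pi.add_apply, integral_add e1 e2, integral_const_mul] at e4
    rw [mul_zero, sub_zero] at hs
    simp only [gaussMoment]
    rw [← e4, ← hs]
    refine integral_congr_ae (Eventually.of_forall fun x => ?_)
    simp [monom, pow_succ, cplx, EuclideanSpace.inner_single_right]
    ring_nf
    simp [Complex.I_sq]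
    ring
  refine mul_left_cancel₀ (mul_ne_zero two_ne_zero hb') ?_
  field_simp
  linear_combination (-1) * hfin

/-- The conjugate operator ∂₁ + i∂₂ = 2∂_ζ̄ kills the power of ζ; with j = 0 there is no conjugate
factor to lower, so the recurrence has one term. -/
theorem gaussMoment_zero_succ {b : ℝ} (hb : 0 < b) (q : Plane) (s t : ℂ) (k : ℕ) :
    gaussMoment b q s t 0 (k + 1) =
      (t + Complex.I * cplx q / (2 * b)) * gaussMoment b q s t 0 k := by
  obtain ⟨h0, i0⟩ := gaussMoment_lineDeriv hb q s t 0 k (EuclideanSpace.single 0 1)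
  obtain ⟨h1, i1⟩ := gaussMoment_lineDeriv hb q s t 0 k (EuclideanSpace.single 1 1)
  have hs := integral_add i0 (i1.const_mul Complex.I)
  rw [integral_const_mul, h0, h1] at hs
  have hb' : (b : ℂ) ≠ 0 := by exact_mod_cast hb.ne'
  have e2 := (integrable_mul_gaussWave hb q s t 0 k).const_mul
    (2 * b * t + Complex.I * cplx q)
  have e3 := (integrable_mul_gaussWave hb q s t 0 (k + 1)).const_mul (2 * b : ℂ)
  have hfin : (2 * b * t + Complex.I * cplx q) * gaussMoment b q s t 0 k -
      2 * b * gaussMoment b q s t 0 (k + 1) = 0 := by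
    have e4 := integral_sub e2 e3
    simp only [integral_const_mul] at e4
    rw [mul_zero, add_zero] at hs
    simp only [gaussMoment]
    rw [← e4, ← hs]
    refine integral_congr_ae (Eventually.of_forall fun x => ?_)
    simp [monom, pow_succ, cplx, EuclideanSpace.inner_single_right]
    ring_nf
    simp [Complex.I_sq]
  refine mul_left_cancel₀ (mul_ne_zero two_ne_zero hb') ?_
  field_simp
  linear_combination (-1) * hfin

/-- The closed form obeys the recurrence of `gaussMoment_succ_left`, by Pascal's rule and k·C(k-1,
i) = (i+1)·C(k, i+1). -/
theorem sum_choose_succ_left (b S T : ℂ) (j k : ℕ) :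
    ∑ i ∈ Finset.range (j + 2), ((j + 1).choose i : ℂ) * k.choose i * i.factorial / b ^ i *
        S ^ (j + 1 - i) * T ^ (k - i) =
      k / b * ∑ i ∈ Finset.range (j + 1), (j.choose i : ℂ) * (k - 1).choose i * i.factorial /
        b ^ i * S ^ (j - i) * T ^ (k - 1 - i) +
      S * ∑ i ∈ Finset.range (j + 1), (j.choose i : ℂ) * k.choose i * i.factorial / b ^ i *
        S ^ (j - i) * T ^ (k - i) := by
  have h2 : ∑ i ∈ Finset.range (j + 1), (j.choose i : ℂ) * k.choose i * i.factorial / b ^ i *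
      S ^ (j - i) * T ^ (k - i) = (∑ i ∈ Finset.range (j + 1), (j.choose (i + 1) : ℂ) *
        k.choose (i + 1) * (i + 1).factorial / b ^ (i + 1) * S ^ (j - (i + 1)) *
        T ^ (k - (i + 1))) + S ^ j * T ^ k := by
    have := Finset.sum_range_succ' (fun i => (j.choose i : ℂ) * k.choose i * i.factorial /
      b ^ i * S ^ (j - i) * T ^ (k - i)) (j + 1)
    rw [Finset.sum_range_succ] at this
    simpa using this
  rw [h2, Finset.sum_range_succ' _ (j + 1)]
  have key : ∀ i ∈ Finset.range (j + 1),
      ((j + 1).choose (i + 1) : ℂ) * k.choose (i + 1) * (i + 1).factorial / b ^ (i + 1) *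
        S ^ (j + 1 - (i + 1)) * T ^ (k - (i + 1)) =
      k / b * ((j.choose i : ℂ) * (k - 1).choose i * i.factorial / b ^ i * S ^ (j - i) *
        T ^ (k - 1 - i)) + S * ((j.choose (i + 1) : ℂ) *
        k.choose (i + 1) * (i + 1).factorial / b ^ (i + 1) * S ^ (j - (i + 1)) *
        T ^ (k - (i + 1))) := by
    intro i hi
    have e1 : k - 1 - i = k - (i + 1) := by omega
    have e2 : j + 1 - (i + 1) = j - i := by omega
    rw [e1, e2, Nat.choose_succ_succ]
    have e3 : (k : ℂ) * (k - 1).choose i = (i + 1) * k.choose (i + 1) := by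
      rcases k with _ | k
      · simp
      · have := Nat.add_one_mul_choose_eq k i
        rw [add_tsub_cancel_right]
        exact_mod_cast this.trans (mul_comm _ _)
    -- At i = j the exponent `j - (i + 1)` truncates, so a factor S cannot be split off; there the
    -- coefficient C(j, i+1) is zero.
    rcases (Finset.mem_range_succ_iff.1 hi).eq_or_lt with rfl | hlt
    · rw [Nat.choose_succ_self, Nat.factorial_succ]
      push_cast
      linear_combination (-(i.factorial : ℂ) * i.choose i * S ^ (i - i) * T ^ (k - (i + 1)) /
        b ^ (i + 1)) * e3
    · have e4 : S ^ (j - i) = S * S ^ (j - (i + 1)) := by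
        rw [← pow_succ']; congr 1; omega
      rw [e4, Nat.factorial_succ]
      push_cast
      linear_combination (-(i.factorial : ℂ) * j.choose i * S * S ^ (j - (i + 1)) *
        T ^ (k - (i + 1)) / b ^ (i + 1)) * e3
  rw [Finset.sum_congr rfl key, Finset.sum_add_distrib, ← Finset.mul_sum, ← Finset.mul_sum]
  simp [pow_succ]
  ring

theorem gaussMoment_eq_sum {b : ℝ} (hb : 0 < b) (q : Plane) (s t : ℂ) (j k : ℕ) :
    gaussMoment b q s t j k = (Real.pi / b * Real.exp (-‖q‖ ^ 2 / (4 * b)) : ℝ) *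
      ∑ i ∈ Finset.range (j + 1), (j.choose i : ℂ) * k.choose i * i.factorial / b ^ i *
        (s + Complex.I * starRingEnd ℂ (cplx q) / (2 * b)) ^ (j - i) *
        (t + Complex.I * cplx q / (2 * b)) ^ (k - i) := by
  have hb' : (b : ℂ) ≠ 0 := by exact_mod_cast hb.ne'
  set S := s + Complex.I * starRingEnd ℂ (cplx q) / (2 * b) with hS
  set T := t + Complex.I * cplx q / (2 * b) with hT
  set G := ((Real.pi / b * Real.exp (-‖q‖ ^ 2 / (4 * b)) : ℝ) : ℂ) with hG
  induction j generalizing k with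
  | zero =>
    induction k with
    | zero =>
      simp only [gaussMoment, monom]
      simp [integral_gaussWave hb q, G]
    | succ k ih =>
      rw [gaussMoment_zero_succ hb, ih]
      simp [pow_succ]
      ring
  | succ j ih =>
    rw [gaussMoment_succ_left hb, ih, ih, sum_choose_succ_left, ← hS]
    ring

/-! ### Ambiguity function and Wigner distribution of the reference state. -/

/-- The ambiguity function `∫ f(s + p) conj(f(s - p)) exp (i⟨q, s⟩) ds`. -/
def ambig (f : Plane → ℂ) (p q : Plane) : ℂ :=
  ∫ s : Plane, f (s + p) * starRingEnd ℂ (f (s - p)) *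
    Complex.exp ((inner ℝ q s : ℝ) * Complex.I)

/-- The Laguerre polynomial of degree `N`. -/
def laguerre (N : ℕ) (r : ℝ) : ℝ :=
  ∑ j ∈ Finset.range (N + 1), (N.choose j : ℝ) * (-r) ^ j / j.factorial

theorem planck_pos {E : ℝ} (hE : 0 < E) (N : ℕ) : 0 < planck E N := by
  unfold planck; positivity

theorem referenceConst_sq {E : ℝ} (hE : 0 < E) (N : ℕ) :
    ((N + 1 : ℝ) ^ ((N + 1 : ℝ) / 2) /
      (E ^ ((N + 1 : ℝ) / 2) * √(Real.pi * (N.factorial : ℝ)))) ^ 2 =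
      (1 / planck E N) ^ (N + 1) / (Real.pi * N.factorial) := by
  have h : ∀ y : ℝ, 0 < y → (y ^ ((N + 1 : ℝ) / 2)) ^ 2 = y ^ (N + 1) := by
    intro y hy
    rw [← Real.rpow_natCast, ← Real.rpow_mul hy.le, ← Real.rpow_natCast]
    congr 1
    push_cast
    ring
  rw [div_pow, mul_pow, h _ (by positivity), h _ hE, Real.sq_sqrt (by positivity), planck,
    one_div_div, div_pow, div_div]

/-- By the parallelogram law the two Gaussians merge into one in s, leaving the moment with shifts
-p̄ and p. The frequency q moves these shifts to -T̄ and T, so only powers of -|T|² occur, and the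
reversed moment sum is a Laguerre polynomial. -/
theorem ambig_referenceStateFun {E : ℝ} (hE : 0 < E) (N : ℕ) (p q : Plane) :
    ambig (referenceStateFun E N) p q =
      (Real.exp (-‖p‖ ^ 2 / planck E N - planck E N * ‖q‖ ^ 2 / 4) *
        laguerre N (‖cplx p + (planck E N / 2 : ℝ) * Complex.I * cplx q‖ ^ 2 / planck E N) : ℝ) := by
  have hh := planck_pos hE N
  set ħ := planck E N with hħ
  set C : ℝ := (N + 1 : ℝ) ^ ((N + 1 : ℝ) / 2) /
      (E ^ ((N + 1 : ℝ) / 2) * √(Real.pi * (N.factorial : ℝ))) with hC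
  have hC2 : C ^ 2 = (1 / ħ) ^ (N + 1) / (Real.pi * N.factorial) := referenceConst_sq hE N
  have hb : (N + 1 : ℝ) / (2 * E) = 1 / (2 * ħ) := by
    rw [hħ, planck]; field_simp
  have h1 : ∀ s : Plane, referenceStateFun E N (s + p) *
      starRingEnd ℂ (referenceStateFun E N (s - p)) *
      Complex.exp ((inner ℝ q s : ℝ) * Complex.I) =
      ((C ^ 2 * Real.exp (-(1 / ħ) * ‖p‖ ^ 2) : ℝ) : ℂ) *
        (monom (-starRingEnd ℂ (cplx p)) (cplx p) N N s * gaussWave (1 / ħ) q s) := by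
    intro s
    have e1 : Real.exp (-(1 / (2 * ħ)) * ‖s + p‖ ^ 2) * Real.exp (-(1 / (2 * ħ)) * ‖s - p‖ ^ 2) =
        Real.exp (-(1 / ħ) * ‖p‖ ^ 2) * Real.exp (-(1 / ħ) * ‖s‖ ^ 2) := by
      rw [← Real.exp_add, ← Real.exp_add]
      congr 1
      have := parallelogram_law_with_norm ℝ s p
      field_simp
      linarith
    have e2 : gaussWave (1 / ħ) q s = (Real.exp (-(1 / ħ) * ‖s‖ ^ 2) : ℝ) *
        Complex.exp ((inner ℝ q s : ℝ) * Complex.I) := by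
      rw [gaussWave, Complex.exp_add, mul_comm Complex.I]
      push_cast
      rfl
    have e3 : ∀ x : Plane, referenceStateFun E N x =
        (C : ℂ) * cplx x ^ N * ((Real.exp (-(1 / (2 * ħ)) * ‖x‖ ^ 2) : ℝ) : ℂ) := by
      intro x
      rw [referenceStateFun, hb]
      rfl
    rw [e3, e3, e2, monom]
    simp only [map_mul, map_pow, Complex.conj_ofReal, cplx_add, cplx_sub, map_sub]
    have e1' := congrArg (fun r : ℝ => (r : ℂ)) e1
    push_cast at e1' ⊢
    linear_combination ((C : ℂ) ^ 2 * (cplx s + cplx p) ^ N *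
      (starRingEnd ℂ (cplx s) - starRingEnd ℂ (cplx p)) ^ N *
      Complex.exp ((inner ℝ q s : ℝ) * Complex.I)) * e1'
  set T : ℂ := cplx p + (ħ / 2 : ℝ) * Complex.I * cplx q with hT
  have hST : (-starRingEnd ℂ (cplx p) + Complex.I * starRingEnd ℂ (cplx q) /
      (2 * ((1 / ħ : ℝ) : ℂ))) = - starRingEnd ℂ T := by
    have h2 : starRingEnd ℂ 2 = 2 := map_ofNat _ 2
    rw [hT, one_div]
    push_cast
    simp only [map_add, map_mul, map_div₀, Complex.conj_ofReal, Complex.conj_I, h2]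
    rw [div_eq_mul_inv, mul_inv, inv_inv]
    ring
  have hTT : cplx p + Complex.I * cplx q / (2 * ((1 / ħ : ℝ) : ℂ)) = T := by
    rw [hT, one_div]
    push_cast
    rw [div_eq_mul_inv, mul_inv, inv_inv]
    ring
  have hTn : starRingEnd ℂ T * T = ((‖T‖ ^ 2 : ℝ) : ℂ) := by
    rw [Complex.conj_mul']; push_cast; rfl
  unfold ambig
  simp only [h1]
  rw [integral_const_mul]
  change _ * gaussMoment _ _ _ _ _ _ = _
  rw [gaussMoment_eq_sum (by positivity), hST, hTT]
  have hsum : ∑ i ∈ Finset.range (N + 1), (N.choose i : ℂ) * N.choose i * i.factorial /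
      ((1 / ħ : ℝ) : ℂ) ^ i * (-starRingEnd ℂ T) ^ (N - i) * T ^ (N - i) =
      ((N.factorial * ħ ^ N * laguerre N (‖T‖ ^ 2 / ħ) : ℝ) : ℂ) := by
    rw [laguerre, ← Finset.sum_range_reflect, Finset.mul_sum, Complex.ofReal_sum]
    refine Finset.sum_congr rfl fun i hi => ?_
    have hi' := Finset.mem_range_succ_iff.1 hi
    have e0 : N + 1 - 1 - i = N - i := by omega
    have e1 : N - (N - i) = i := by omega
    rw [e0, e1, Nat.choose_symm hi', mul_assoc, ← mul_pow, neg_mul, hTn]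
    have e2 : (N.factorial : ℂ) = N.choose (N - i) * (N - i).factorial * i.factorial := by
      rw [Nat.choose_symm hi', mul_right_comm]
      exact_mod_cast (Nat.choose_mul_factorial_mul_factorial hi').symm
    have e3 : (ħ : ℂ) ≠ 0 := by exact_mod_cast hh.ne'
    have e4 : (ħ : ℂ) ^ N = ħ ^ i * ħ ^ (N - i) := by rw [← pow_add]; congr 1; omega
    have e5 : (i.factorial : ℂ) ≠ 0 := by exact_mod_cast i.factorial_ne_zero
    have e6 : ((N - i).factorial : ℂ) ≠ 0 := by exact_mod_cast (N - i).factorial_ne_zero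
    push_cast
    rw [e2, e4, one_div, inv_pow, ← neg_div, div_pow, Nat.choose_symm hi']
    field_simp
  rw [hsum, ← Complex.ofReal_mul, ← Complex.ofReal_mul, hC2]
  congr 1
  have e7 : Real.exp (-‖p‖ ^ 2 / ħ - ħ * ‖q‖ ^ 2 / 4) =
      Real.exp (-(1 / ħ) * ‖p‖ ^ 2) * Real.exp (-‖q‖ ^ 2 / (4 * (1 / ħ))) := by
    rw [← Real.exp_add]
    congr 1
    field_simp
    ring
  rw [e7]
  have e8 : (N.factorial : ℝ) ≠ 0 := by exact_mod_cast N.factorial_ne_zero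
  have e9 : Real.pi ≠ 0 := Real.pi_ne_zero
  rw [one_div, inv_pow, pow_succ]
  field_simp

/-- For a function of definite parity, the Wigner distribution is a rescaled ambiguity
function. -/
theorem wigner_eq_ambig_of_parity {ħ : ℝ} (hh : 0 < ħ) {f : Plane → ℂ} {ε : ℝ}
    (hf : ∀ x, f (-x) = ε * f x) (w : PhaseSpace) :
    wigner ħ f w = ((ε / (Real.pi * ħ) ^ 2 : ℝ) : ℂ) * ambig f w.1 (-(2 / ħ) • w.2) := by
  rw [wigner, ambig]
  have h := Measure.integral_comp_smul (volume : Measure Plane)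
    (fun v : Plane => f (w.1 + (1 / 2 : ℝ) • v) * starRingEnd ℂ (f (w.1 - (1 / 2 : ℝ) • v)) *
      Complex.exp (-((inner ℝ v w.2 / ħ : ℝ) : ℂ) * Complex.I)) 2
  have h2 : ∀ s : Plane, f (w.1 + (1 / 2 : ℝ) • (2 : ℝ) • s) *
      starRingEnd ℂ (f (w.1 - (1 / 2 : ℝ) • (2 : ℝ) • s)) *
      Complex.exp (-((inner ℝ ((2 : ℝ) • s) w.2 / ħ : ℝ) : ℂ) * Complex.I) =
      ε * (f (s + w.1) * starRingEnd ℂ (f (s - w.1)) *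
        Complex.exp ((inner ℝ (-(2 / ħ) • w.2) s : ℝ) * Complex.I)) := by
    intro s
    -- After v = 2s, parity turns the reflected argument x - s into the translated one s - x, at the
    -- cost of the sign ε.
    have e : w.1 - s = -(s - w.1) := by abel
    rw [smul_smul, one_div, inv_mul_cancel₀ two_ne_zero, one_smul, e, hf, map_mul,
      Complex.conj_ofReal, add_comm w.1, inner_smul_left, inner_smul_left, real_inner_comm s]
    rw [show -((((starRingEnd ℝ) 2 * inner ℝ s w.2 / ħ : ℝ)) : ℂ) =
      (((starRingEnd ℝ) (-(2 / ħ)) * inner ℝ s w.2 : ℝ) : ℂ) by simp; ring]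
    ring
  simp only [h2, integral_const_mul] at h
  rw [finrank_euclideanSpace_fin, abs_of_pos (by positivity), eq_inv_smul_iff₀ (by positivity)] at h
  rw [← h, Complex.real_smul]
  push_cast
  have : (ħ : ℂ) ≠ 0 := by exact_mod_cast hh.ne'
  have : (Real.pi : ℂ) ≠ 0 := by exact_mod_cast Real.pi_ne_zero
  simp only [mul_comm _ Complex.I]
  field_simp
  norm_num

theorem referenceStateFun_neg (E : ℝ) (N : ℕ) (x : Plane) :
    referenceStateFun E N (-x) = ((-1 : ℝ) ^ N : ℝ) * referenceStateFun E N x := by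
  have : (((-x) 0 : ℝ) : ℂ) + Complex.I * (((-x) 1 : ℝ) : ℂ) =
      -1 * ((x 0 : ℂ) + Complex.I * (x 1 : ℂ)) := by
    simp; ring
  rw [referenceStateFun, referenceStateFun, this, norm_neg, mul_pow]
  push_cast
  ring

/-- Write r^j/j! = 4^j (r/4)^j/j! ≤ 4^j e^{r/4} and sum the binomial expansion of (4+1)^N. The
fraction 1/4 is chosen to spend only half of the Gaussian decay of the Wigner function. -/
theorem abs_laguerre_le (N : ℕ) {r : ℝ} (hr : 0 ≤ r) :
    |laguerre N r| ≤ 5 ^ N * Real.exp (r / 4) := by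
  have h5 : (5 : ℝ) ^ N = ∑ j ∈ Finset.range (N + 1), (4 : ℝ) ^ j * N.choose j := by
    have := add_pow (4 : ℝ) 1 N
    norm_num at this
    exact this
  rw [laguerre, h5, Finset.sum_mul]
  refine (Finset.abs_sum_le_sum_abs _ _).trans (Finset.sum_le_sum fun j _ => ?_)
  rw [abs_div, abs_mul, abs_pow, abs_neg, abs_of_nonneg hr, Nat.abs_cast, Nat.abs_cast]
  have := Real.pow_div_factorial_le_exp (r / 4) (by positivity) j
  calc (N.choose j : ℝ) * r ^ j / j.factorial
      = 4 ^ j * N.choose j * ((r / 4) ^ j / j.factorial) := by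
        rw [div_pow]; field_simp
    _ ≤ _ := by gcongr

/-- Gaussian bound for the Wigner distribution of the reference state. -/
theorem norm_wigner_referenceStateFun_le {E : ℝ} (hE : 0 < E) (N : ℕ) (w : PhaseSpace) :
    ‖wigner (planck E N) (referenceStateFun E N) w‖ ≤
      1 / (Real.pi * planck E N) ^ 2 * (5 ^ N *
        Real.exp (-(‖w.1‖ ^ 2 + ‖w.2‖ ^ 2) / (2 * planck E N))) := by
  have hh := planck_pos hE N
  rw [wigner_eq_ambig_of_parity hh (referenceStateFun_neg E N), ambig_referenceStateFun hE]
  set ħ := planck E N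
  rw [norm_mul, Complex.norm_real, Complex.norm_real, norm_div, norm_pow, norm_neg, norm_one,
    one_pow, norm_pow, Real.norm_of_nonneg (by positivity : 0 ≤ Real.pi * ħ)]
  gcongr
  rw [norm_mul, Real.norm_eq_abs, Real.norm_eq_abs, Real.abs_exp]
  set t := ‖cplx w.1 + (ħ / 2 : ℝ) * Complex.I * cplx (-(2 / ħ) • w.2)‖ ^ 2 / ħ with ht
  have ht0 : 0 ≤ t := by positivity
  -- Consequently t/4 costs at most half of the available exponent (|x|² + |ξ|²)/ħ.
  have htle : t ≤ 2 * (‖w.1‖ ^ 2 + ‖w.2‖ ^ 2) / ħ := by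
    rw [ht]
    gcongr
    have e : (ħ / 2 : ℝ) * Complex.I * cplx (-(2 / ħ) • w.2) = -(Complex.I * cplx w.2) := by
      have : (ħ : ℂ) ≠ 0 := by exact_mod_cast hh.ne'
      rw [cplx_smul]; push_cast; field_simp
    have h2 : ‖cplx w.1 + (ħ / 2 : ℝ) * Complex.I * cplx (-(2 / ħ) • w.2)‖ ≤ ‖w.1‖ + ‖w.2‖ := by
      rw [e]
      refine (norm_add_le _ _).trans ?_
      rw [norm_neg, norm_mul, Complex.norm_I, one_mul, norm_cplx, norm_cplx]
    calc _ ≤ (‖w.1‖ + ‖w.2‖) ^ 2 := by gcongr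
      _ ≤ _ := by nlinarith [sq_nonneg (‖w.1‖ - ‖w.2‖)]
  calc Real.exp (-‖w.1‖ ^ 2 / ħ - ħ * ‖-(2 / ħ) • w.2‖ ^ 2 / 4) * |laguerre N t|
      ≤ Real.exp (-‖w.1‖ ^ 2 / ħ - ħ * ‖-(2 / ħ) • w.2‖ ^ 2 / 4) *
        (5 ^ N * Real.exp (t / 4)) := by gcongr; exact abs_laguerre_le N ht0
    _ = 5 ^ N * Real.exp (-‖w.1‖ ^ 2 / ħ - ħ * ‖-(2 / ħ) • w.2‖ ^ 2 / 4 + t / 4) := by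
      rw [Real.exp_add]; ring
    _ ≤ _ := by
      gcongr
      rw [norm_smul, norm_neg, Real.norm_of_nonneg (by positivity), mul_pow, div_pow]
      calc -‖w.1‖ ^ 2 / ħ - ħ * (2 ^ 2 / ħ ^ 2 * ‖w.2‖ ^ 2) / 4 + t / 4
          ≤ -‖w.1‖ ^ 2 / ħ - ħ * (2 ^ 2 / ħ ^ 2 * ‖w.2‖ ^ 2) / 4 +
            (2 * (‖w.1‖ ^ 2 + ‖w.2‖ ^ 2) / ħ) / 4 := by gcongr
        _ = _ := by field_simp; ring

/-- The Wigner distributions of the reference states tend to zero, uniformly outside a ball of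
phase space. -/
theorem exists_wigner_referenceStateFun_tail {E : ℝ} (hE : 0 < E) :
    ∃ δ : ℕ → ℝ, Tendsto δ atTop (𝓝 0) ∧ ∀ (N : ℕ) (w : PhaseSpace),
      4 * E ≤ ‖w.1‖ ^ 2 + ‖w.2‖ ^ 2 →
        ‖wigner (planck E N) (referenceStateFun E N) w‖ ≤ δ N := by
  -- For |w|² ≥ 4E the Gaussian exponent |w|²/(2ħ) is at least 2(N+1), so e² per level competes
  -- against 5 per level; the prefactor ħ⁻² is only polynomial in N.
  have hq : 5 / Real.exp 2 < 1 := by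
    rw [div_lt_one (Real.exp_pos _)]
    have h1 : Real.exp 2 = Real.exp 1 * Real.exp 1 := by rw [← Real.exp_add]; norm_num
    nlinarith [Real.exp_one_gt_d9]
  refine ⟨fun N => (Real.pi * E)⁻¹ ^ 2 * 5⁻¹ *
    (((N + 1 : ℕ) : ℝ) ^ 2 * (5 / Real.exp 2) ^ (N + 1)), ?_, ?_⟩
  · have h := tendsto_pow_const_mul_const_pow_of_lt_one 2 (by positivity) hq
    have h' := (tendsto_add_atTop_iff_nat 1).2 h
    simpa using h'.const_mul ((Real.pi * E)⁻¹ ^ 2 * 5⁻¹)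
  · intro N w hw
    refine (norm_wigner_referenceStateFun_le hE N w).trans ?_
    have hexp : Real.exp (-(‖w.1‖ ^ 2 + ‖w.2‖ ^ 2) / (2 * planck E N)) ≤
        (Real.exp 2)⁻¹ ^ (N + 1) := by
      rw [← Real.exp_neg, ← Real.exp_nat_mul]
      gcongr
      rw [div_le_iff₀ (by have := planck_pos hE N; positivity), planck]
      push_cast
      field_simp
      linarith
    calc _ ≤ 1 / (Real.pi * planck E N) ^ 2 * (5 ^ N * (Real.exp 2)⁻¹ ^ (N + 1)) := by gcongr
      _ = _ := by
        rw [planck]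
        push_cast
        field_simp
        ring

/-! ### Integrability of symbols, and boundedness of Wigner distributions of general states. -/

theorem integrable_exp_neg_mul_norm {c : ℝ} (hc : 0 < c) :
    Integrable (fun x : Plane => Real.exp (-c * ‖x‖)) := by
  have h := integrable_one_add_norm (μ := (volume : Measure Plane)) (r := 3)
    (by rw [finrank_euclideanSpace_fin]; norm_num)
  refine (h.const_mul (6 * Real.exp c / c ^ 3)).mono' (by fun_prop)
    (Eventually.of_forall fun x => ?_)
  rw [Real.norm_eq_abs, Real.abs_exp, Real.rpow_neg (by positivity)]
  have h1 := Real.pow_div_factorial_le_exp (c * (1 + ‖x‖)) (by positivity) 3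
  have h2 : Real.exp (c * (1 + ‖x‖)) = Real.exp c * Real.exp (c * ‖x‖) := by
    rw [← Real.exp_add]; ring_nf
  rw [h2] at h1
  norm_num [Nat.factorial] at h1 ⊢
  rw [Real.exp_neg, inv_eq_one_div, ← div_eq_mul_inv, div_div, div_le_div_iff₀ (by positivity)
    (by positivity)]
  rw [mul_pow] at h1
  linarith

/-- A measurable symbol of exponential decay is integrable over phase space. -/
theorem HasExponentialDecay.integrable {a : PhaseSpace → ℝ} (h : HasExponentialDecay a)
    (ha : Measurable a) : Integrable a := by
  obtain ⟨C, c, hc, hle⟩ := h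
  have h1 := ((integrable_exp_neg_mul_norm hc).mul_prod (integrable_exp_neg_mul_norm hc)).const_mul C
  refine h1.mono' ha.aestronglyMeasurable (Eventually.of_forall fun w => ?_)
  rw [Real.norm_eq_abs]
  refine (hle w).trans_eq ?_
  rw [← Real.exp_add, mul_add]

/-- The density `f(X + v/2) conj(f(X - v/2))`. -/
def corr (f : Plane → ℂ) (X v : Plane) : ℂ :=
  f (X + (1 / 2 : ℝ) • v) * starRingEnd ℂ (f (X - (1 / 2 : ℝ) • v))

variable {f : Plane → ℂ}

theorem stronglyMeasurable_corr (hf : StronglyMeasurable f) :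
    StronglyMeasurable (fun z : Plane × Plane => corr f z.1 z.2) := by
  have h1 : StronglyMeasurable (fun z : Plane × Plane => f (z.1 + (1 / 2 : ℝ) • z.2)) :=
    hf.comp_measurable (by fun_prop)
  have h2 : StronglyMeasurable (fun z : Plane × Plane => f (z.1 - (1 / 2 : ℝ) • z.2)) :=
    hf.comp_measurable (by fun_prop)
  exact h1.mul (Complex.continuous_conj.comp_stronglyMeasurable h2)

theorem norm_corr_le (X v : Plane) :
    ‖corr f X v‖ ≤ 1 / 2 * (‖f (X + (1 / 2 : ℝ) • v)‖ ^ 2 + ‖f (X - (1 / 2 : ℝ) • v)‖ ^ 2) := by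
  rw [corr, norm_mul, RCLike.norm_conj]
  nlinarith [sq_nonneg (‖f (X + (1 / 2 : ℝ) • v)‖ - ‖f (X - (1 / 2 : ℝ) • v)‖)]

theorem integrable_norm_sq (hf2 : MemLp f 2 volume) : Integrable (fun x => ‖f x‖ ^ 2) :=
  (memLp_two_iff_integrable_sq_norm hf2.1).1 hf2

/-- The pointwise bound averages two copies of |f|² rescaled by 1/2, each with Jacobian 2² = 4. The
bound is uniform in X, which makes the Wigner distribution a bounded function. -/
theorem integrable_corr_right (hf : StronglyMeasurable f) (hf2 : MemLp f 2 volume) (X : Plane) :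
    Integrable (fun v => corr f X v) ∧ ∫ v, ‖corr f X v‖ ≤ 4 * ∫ x, ‖f x‖ ^ 2 := by
  have h := integrable_norm_sq hf2
  have hp : Integrable (fun v : Plane => ‖f (X + (1 / 2 : ℝ) • v)‖ ^ 2) :=
    (h.comp_add_left X).comp_smul (R := (1 / 2 : ℝ)) (by norm_num)
  have hm : Integrable (fun v : Plane => ‖f (X - (1 / 2 : ℝ) • v)‖ ^ 2) :=
    (h.comp_sub_left X).comp_smul (R := (1 / 2 : ℝ)) (by norm_num)
  have hI := (hp.add hm).const_mul (1 / 2)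
  have hmeas : AEStronglyMeasurable (fun v => corr f X v) volume :=
    ((stronglyMeasurable_corr hf).comp_measurable (measurable_prodMk_left (x := X)))
      |>.aestronglyMeasurable
  have hint : Integrable (fun v => corr f X v) :=
    hI.mono' hmeas (Eventually.of_forall fun v => norm_corr_le X v)
  refine ⟨hint, ?_⟩
  refine (integral_mono hint.norm hI fun v => norm_corr_le X v).trans_eq ?_
  have e1 : ∫ v : Plane, ‖f (X + (1 / 2 : ℝ) • v)‖ ^ 2 = 4 * ∫ x, ‖f x‖ ^ 2 := by
    rw [Measure.integral_comp_smul volume (fun v : Plane => ‖f (X + v)‖ ^ 2),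
      integral_add_left_eq_self (fun x => ‖f x‖ ^ 2), finrank_euclideanSpace_fin]
    norm_num
  have e2 : ∫ v : Plane, ‖f (X - (1 / 2 : ℝ) • v)‖ ^ 2 = 4 * ∫ x, ‖f x‖ ^ 2 := by
    rw [Measure.integral_comp_smul volume (fun v : Plane => ‖f (X - v)‖ ^ 2),
      integral_sub_left_eq_self (fun x => ‖f x‖ ^ 2), finrank_euclideanSpace_fin]
    norm_num
  simp only [Pi.add_apply]
  rw [integral_const_mul, integral_add hp hm, e1, e2]
  ring

/-- In X only translations occur, so no Jacobian appears; this yields the sharp bound of the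
ambiguity function by the L² mass. -/
theorem integrable_corr_left (hf : StronglyMeasurable f) (hf2 : MemLp f 2 volume) (v : Plane) :
    Integrable (fun X => corr f X v) ∧ ∫ X, ‖corr f X v‖ ≤ ∫ x, ‖f x‖ ^ 2 := by
  have h := integrable_norm_sq hf2
  have hp : Integrable (fun X : Plane => ‖f (X + (1 / 2 : ℝ) • v)‖ ^ 2) :=
    h.comp_add_right _
  have hm : Integrable (fun X : Plane => ‖f (X - (1 / 2 : ℝ) • v)‖ ^ 2) :=
    h.comp_sub_right _
  have hI := (hp.add hm).const_mul (1 / 2)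
  have hmeas : AEStronglyMeasurable (fun X => corr f X v) volume :=
    ((stronglyMeasurable_corr hf).comp_measurable (measurable_prodMk_right (y := v)))
      |>.aestronglyMeasurable
  have hint : Integrable (fun X => corr f X v) :=
    hI.mono' hmeas (Eventually.of_forall fun X => norm_corr_le X v)
  refine ⟨hint, ?_⟩
  refine (integral_mono hint.norm hI fun X => norm_corr_le X v).trans_eq ?_
  simp only [Pi.add_apply]
  rw [integral_const_mul, integral_add hp hm, integral_add_right_eq_self (fun x => ‖f x‖ ^ 2),
    integral_sub_right_eq_self (fun x => ‖f x‖ ^ 2)]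
  ring

/-- The phase `exp (-(i/ħ)⟨v, ξ⟩)`. -/
def phase (ħ : ℝ) (v ξ : Plane) : ℂ :=
  Complex.exp (-((inner ℝ v ξ / ħ : ℝ) : ℂ) * Complex.I)

theorem norm_phase (ħ : ℝ) (v ξ : Plane) : ‖phase ħ v ξ‖ = 1 := by
  rw [phase, ← Complex.ofReal_neg, Complex.norm_exp_ofReal_mul_I]

theorem continuous_phase (ħ : ℝ) : Continuous (fun z : Plane × Plane => phase ħ z.1 z.2) := by
  unfold phase; fun_prop

theorem wigner_eq (ħ : ℝ) (f : Plane → ℂ) (w : PhaseSpace) :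
    wigner ħ f w = ((1 / (4 * Real.pi ^ 2 * ħ ^ 2) : ℝ) : ℂ) *
      ∫ v : Plane, corr f w.1 v * phase ħ v w.2 := rfl

theorem stronglyMeasurable_corr_mul_phase (ħ : ℝ) (hf : StronglyMeasurable f) :
    StronglyMeasurable (fun z : PhaseSpace × Plane => corr f z.1.1 z.2 * phase ħ z.2 z.1.2) :=
  ((stronglyMeasurable_corr hf).comp_measurable
    (g := fun z : PhaseSpace × Plane => (z.1.1, z.2)) (by fun_prop)).mul
    ((continuous_phase ħ).stronglyMeasurable.comp_measurable
      (g := fun z : PhaseSpace × Plane => (z.2, z.1.2)) (by fun_prop))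

theorem stronglyMeasurable_wigner (ħ : ℝ) (hf : StronglyMeasurable f) :
    StronglyMeasurable (wigner ħ f) :=
  ((stronglyMeasurable_corr_mul_phase ħ hf).integral_prod_right'
    (ν := (volume : Measure Plane))).const_mul _

theorem norm_wigner_le (ħ : ℝ) (hf : StronglyMeasurable f) (hf2 : MemLp f 2 volume)
    (w : PhaseSpace) :
    ‖wigner ħ f w‖ ≤ |1 / (4 * Real.pi ^ 2 * ħ ^ 2)| * (4 * ∫ x, ‖f x‖ ^ 2) := by
  rw [wigner_eq, norm_mul, Complex.norm_real, Real.norm_eq_abs]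
  gcongr
  refine (norm_integral_le_integral_norm _).trans ?_
  simp only [norm_mul, norm_phase, mul_one]
  exact (integrable_corr_right hf hf2 w.1).2

theorem integrable_mul_wigner (ħ : ℝ) (hf : StronglyMeasurable f) (hf2 : MemLp f 2 volume)
    {a : PhaseSpace → ℂ} (ha : Integrable a) : Integrable (fun w => a w * wigner ħ f w) :=
  ha.mul_bdd (stronglyMeasurable_wigner ħ hf).aestronglyMeasurable
    (Eventually.of_forall (norm_wigner_le ħ hf hf2))

theorem locallyIntegrable_wigner (ħ : ℝ) (hf : StronglyMeasurable f) (hf2 : MemLp f 2 volume) :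
    LocallyIntegrable (wigner ħ f) :=
  (locallyIntegrable_const (|1 / (4 * Real.pi ^ 2 * ħ ^ 2)| * (4 * ∫ x, ‖f x‖ ^ 2))).mono
    (stronglyMeasurable_wigner ħ hf).aestronglyMeasurable
    (Eventually.of_forall fun w => (norm_wigner_le ħ hf hf2 w).trans (le_abs_self _))

theorem integrable_corr_mul_phase (ħ : ℝ) (hf : StronglyMeasurable f) (hf2 : MemLp f 2 volume)
    (w : PhaseSpace) : Integrable (fun v => corr f w.1 v * phase ħ v w.2) := by
  have hp : Continuous (fun v => phase ħ v w.2) := by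
    unfold phase; fun_prop
  refine (integrable_corr_right hf hf2 w.1).1.mul_bdd (c := 1) hp.aestronglyMeasurable ?_
  exact Eventually.of_forall fun v => (norm_phase ħ v w.2).le

/-- The absolute convergence of `∫∫ a(w) f(x + v/2) conj(f(x - v/2)) exp (-(i/ħ)⟨v, ξ⟩) dv dw`. -/
theorem integrable_mul_corr_mul_phase (ħ : ℝ) (hf : StronglyMeasurable f)
    (hf2 : MemLp f 2 volume) {a : PhaseSpace → ℂ} (ha : Integrable a) :
    Integrable (fun z : PhaseSpace × Plane =>
      a z.1 * (corr f z.1.1 z.2 * phase ħ z.2 z.1.2)) := by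
  have hm : AEStronglyMeasurable (fun z : PhaseSpace × Plane =>
      a z.1 * (corr f z.1.1 z.2 * phase ħ z.2 z.1.2)) (volume.prod volume) :=
    ha.1.comp_fst.mul (stronglyMeasurable_corr_mul_phase ħ hf).aestronglyMeasurable
  refine (integrable_prod_iff hm).2 ⟨Eventually.of_forall fun w => ?_, ?_⟩
  · exact (integrable_corr_mul_phase ħ hf hf2 w).const_mul (a w)
  · refine (ha.norm.mul_const (4 * ∫ x, ‖f x‖ ^ 2)).mono' hm.norm.integral_prod_right'
      (Eventually.of_forall fun w => ?_)
    rw [Real.norm_of_nonneg (integral_nonneg fun _ => norm_nonneg _)]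
    simp only [norm_mul, norm_phase, mul_one]
    rw [integral_const_mul]
    gcongr
    exact (integrable_corr_right hf hf2 w.1).2

/-- Common starting point of the Weyl identity and of Parseval: one absolutely convergent integral
over (x, ξ, v), to which Fubini applies in any order. -/
theorem integral_mul_wigner_eq (ħ : ℝ) (hf : StronglyMeasurable f)
    (hf2 : MemLp f 2 volume) {a : PhaseSpace → ℂ} (ha : Integrable a) :
    ∫ w, a w * wigner ħ f w = ((1 / (4 * Real.pi ^ 2 * ħ ^ 2) : ℝ) : ℂ) *
      ∫ z : PhaseSpace × Plane, a z.1 * (corr f z.1.1 z.2 * phase ħ z.2 z.1.2) := by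
  have h := integral_prod _ (integrable_mul_corr_mul_phase ħ hf hf2 ha)
  refine Eq.trans ?_ (congrArg _ h.symm)
  rw [← integral_const_mul]
  refine integral_congr_ae (Eventually.of_forall fun w => ?_)
  simp only [wigner_eq, integral_const_mul]
  ring

/-! ### The Weyl operator and the Wigner distribution -/

/-- The substitution `x = X - v/2`, `y = X + v/2`. -/
def weylShear (z : PhaseSpace × Plane) : Plane × (Plane × Plane) :=
  (z.1.1 - (1 / 2 : ℝ) • z.2, (z.1.1 + (1 / 2 : ℝ) • z.2, z.1.2))

theorem measurePreserving_weylShear : MeasurePreserving weylShear := by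
  -- The substitution factors as ((X, ξ), v) ↦ ((v, ξ), X) ↦ ((v, ξ), X - v/2) ↦ (x, (v, ξ)) ↦ (x,
  -- (x + v, ξ)): permutations and unimodular shears.
  have h1 : MeasurePreserving (fun z : PhaseSpace × Plane => ((z.2, z.1.2), z.1.1)) := by
    have e1 : MeasurePreserving (MeasurableEquiv.prodAssoc : (Plane × Plane) × Plane ≃ᵐ _) :=
      volume_preserving_prodAssoc
    have e2 : MeasurePreserving (Prod.swap : Plane × (Plane × Plane) → _) :=
      Measure.measurePreserving_swap
    have e3 : MeasurePreserving (Prod.map (Prod.swap : Plane × Plane → _) (id : Plane → Plane)) :=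
      MeasurePreserving.prod Measure.measurePreserving_swap (MeasurePreserving.id volume)
    exact e3.comp (e2.comp e1)
  have h2 : MeasurePreserving (fun z : (Plane × Plane) × Plane =>
      (z.1, z.2 - (1 / 2 : ℝ) • z.1.1)) :=
    MeasurePreserving.skew_product (f := id) (g := fun (p : Plane × Plane) (X : Plane) => X - (1 / 2 : ℝ) • p.1)
      (MeasurePreserving.id volume) (by simp only [Function.uncurry_def]; fun_prop)
      (Eventually.of_forall fun p => (measurePreserving_sub_right volume _).map_eq)
  have h3 : MeasurePreserving (Prod.swap : (Plane × Plane) × Plane → _) :=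
    Measure.measurePreserving_swap
  have h4 : MeasurePreserving (fun z : Plane × (Plane × Plane) =>
      (z.1, (z.1 + z.2.1, z.2.2))) :=
    MeasurePreserving.skew_product (f := id)
      (g := fun x p => Prod.map (fun v : Plane => x + v) id p)
      (MeasurePreserving.id volume)
      (by simp only [Function.uncurry_def, Prod.map]; fun_prop)
      (Eventually.of_forall fun x => ((measurePreserving_add_left volume x).prod
        (MeasurePreserving.id volume)).map_eq)
  have h := h4.comp (h3.comp (h2.comp h1))
  convert! h using 1
  ext1 z
  simp only [weylShear, Function.comp_apply, Prod.swap_prod_mk, Prod.mk.injEq, true_and, and_true]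
  module

theorem measurableEmbedding_weylShear : MeasurableEmbedding weylShear := by
  refine Continuous.measurableEmbedding (by unfold weylShear; fun_prop) ?_
  rintro ⟨⟨X, ξ⟩, v⟩ ⟨⟨X', ξ'⟩, v'⟩ h
  simp only [weylShear, Prod.mk.injEq] at h
  obtain ⟨h1, h2, rfl⟩ := h
  have hv : v = v' := by
    have := congrArg₂ (· - ·) h2 h1
    simp only [add_sub_sub_cancel, ← add_smul] at this
    norm_num at this
    exact this
  subst hv
  simpa using h1

theorem weyl_integrand_comp_shear (ħ : ℝ) (f : Plane → ℂ) (a : PhaseSpace → ℝ)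
    (z : PhaseSpace × Plane) :
    starRingEnd ℂ (f (weylShear z).1) *
      ((a ((1 / 2 : ℝ) • ((weylShear z).1 + (weylShear z).2.1), (weylShear z).2.2) : ℂ) *
      Complex.exp (((inner ℝ ((weylShear z).1 - (weylShear z).2.1) (weylShear z).2.2 / ħ : ℝ) : ℂ) *
        Complex.I) * f (weylShear z).2.1) =
      (a z.1 : ℂ) * (corr f z.1.1 z.2 * phase ħ z.2 z.1.2) := by
  have e1 : (1 / 2 : ℝ) • ((weylShear z).1 + (weylShear z).2.1) = z.1.1 := by
    simp only [weylShear]; module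
  have e2 : (weylShear z).1 - (weylShear z).2.1 = -z.2 := by
    simp only [weylShear]; module
  rw [e1, e2, inner_neg_left, neg_div, Complex.ofReal_neg]
  simp only [weylShear, corr, phase]
  ring

/-- The matrix element of the Weyl quantization is the integral of the symbol against the Wigner
distribution. -/
theorem integral_conj_mul_weylOp (ħ : ℝ) (hf : StronglyMeasurable f)
    (hf2 : MemLp f 2 volume) {a : PhaseSpace → ℝ} (ha : Integrable a) :
    ∫ x, starRingEnd ℂ (f x) * weylOp ħ a f x = ∫ w, (a w : ℂ) * wigner ħ f w := by
  have ha' : Integrable (fun w => (a w : ℂ)) := ha.ofReal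
  rw [integral_mul_wigner_eq ħ hf hf2 ha']
  have hint := integrable_mul_corr_mul_phase ħ hf hf2 ha'
  simp only [← weyl_integrand_comp_shear] at hint ⊢
  have hG := (measurePreserving_weylShear.integrable_comp_emb measurableEmbedding_weylShear
    (g := fun z : Plane × (Plane × Plane) => starRingEnd ℂ (f z.1) *
      ((a ((1 / 2 : ℝ) • (z.1 + z.2.1), z.2.2) : ℂ) *
      Complex.exp (((inner ℝ (z.1 - z.2.1) z.2.2 / ħ : ℝ) : ℂ) * Complex.I) * f z.2.1))).1 hint
  rw [measurePreserving_weylShear.integral_comp measurableEmbedding_weylShear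
    (g := fun z : Plane × (Plane × Plane) => starRingEnd ℂ (f z.1) *
      ((a ((1 / 2 : ℝ) • (z.1 + z.2.1), z.2.2) : ℂ) *
      Complex.exp (((inner ℝ (z.1 - z.2.1) z.2.2 / ħ : ℝ) : ℂ) * Complex.I) * f z.2.1))]
  refine Eq.trans ?_ (congrArg _ (integral_prod _ hG).symm)
  rw [← integral_const_mul]
  refine integral_congr_ae (Eventually.of_forall fun x => ?_)
  simp only [weylOp, integral_const_mul]
  rw [mul_left_comm, show (4 * Real.pi ^ 2 * ħ ^ 2) = (2 * Real.pi * ħ) ^ 2 by ring]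

/-- Weighted Cauchy–Schwarz, from the nonnegativity of ∫ g (u - t)² at its minimizer t = ∫ gu / ∫ g.
-/
theorem sq_integral_mul_le {α : Type*} [MeasurableSpace α] {μ : Measure α} {g u : α → ℝ}
    (hg0 : 0 ≤ g) (hg : Integrable g μ) (hgu : Integrable (fun y => g y * u y) μ)
    (hgu2 : Integrable (fun y => g y * u y ^ 2) μ) (hpos : 0 < ∫ y, g y ∂μ) :
    (∫ y, g y * u y ∂μ) ^ 2 ≤ (∫ y, g y ∂μ) * ∫ y, g y * u y ^ 2 ∂μ := by
  set I := ∫ y, g y * u y ∂μ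
  set G := ∫ y, g y ∂μ
  set t := I / G
  have h := integral_nonneg (μ := μ) (f := fun y => g y * (u y - t) ^ 2)
    fun y => mul_nonneg (hg0 y) (sq_nonneg _)
  have e : ∫ y, g y * (u y - t) ^ 2 ∂μ =
      (∫ y, g y * u y ^ 2 ∂μ) - 2 * t * I + t ^ 2 * G := by
    have e1 := integral_add (hgu2.sub (hgu.const_mul (2 * t))) (hg.const_mul (t ^ 2))
    simp only [Pi.sub_apply, integral_sub hgu2 (hgu.const_mul (2 * t)), integral_const_mul] at e1
    rw [← e1]
    refine integral_congr_ae (Eventually.of_forall fun y => ?_)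
    ring
  rw [e] at h
  have e2 : -(2 * t * I) + t ^ 2 * G = -(I ^ 2 / G) := by
    simp only [t]; field_simp; ring
  have h3 : I ^ 2 / G ≤ ∫ y, g y * u y ^ 2 ∂μ := by linarith
  rw [div_le_iff₀ hpos] at h3
  linarith

/-- A Schur-type estimate. After integrating out ξ the kernel is dominated by k(x + y), a sum and
not a difference because the symbol sits at the midpoint. Cauchy–Schwarz with weight k and Fubini
then bound the L² norm. -/
theorem memLp_weylOp (ħ : ℝ) (hf : StronglyMeasurable f) (hf2 : MemLp f 2 volume)
    {a : PhaseSpace → ℝ} (ha : Measurable a) (hdecay : HasExponentialDecay a) :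
    MemLp (weylOp ħ a f) 2 volume := by
  have hsm : StronglyMeasurable (weylOp ħ a f) := by
    refine StronglyMeasurable.const_mul (StronglyMeasurable.integral_prod_right' (f := fun z :
      Plane × (Plane × Plane) => (a ((1 / 2 : ℝ) • (z.1 + z.2.1), z.2.2) : ℂ) *
      Complex.exp (((inner ℝ (z.1 - z.2.1) z.2.2 / ħ : ℝ) : ℂ) * Complex.I) * f z.2.1) ?_) _
    have h1 : StronglyMeasurable (fun z : Plane × (Plane × Plane) =>
        (a ((1 / 2 : ℝ) • (z.1 + z.2.1), z.2.2) : ℂ)) :=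
      (Complex.measurable_ofReal.comp (ha.comp (by fun_prop))).stronglyMeasurable
    have h2 : StronglyMeasurable (fun z : Plane × (Plane × Plane) =>
        Complex.exp (((inner ℝ (z.1 - z.2.1) z.2.2 / ħ : ℝ) : ℂ) * Complex.I)) :=
      Continuous.stronglyMeasurable (by fun_prop)
    exact (h1.mul h2).mul (hf.comp_measurable (by fun_prop))
  obtain ⟨C, c, hc, hle⟩ := hdecay
  have hC : 0 ≤ C := by
    have := (abs_nonneg _).trans (hle 0)
    simpa using this
  set k : Plane → ℝ := fun z => Real.exp (-c * ‖(1 / 2 : ℝ) • z‖) with hk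
  have hkc : Continuous k := by fun_prop
  have hk1 : ∀ z, ‖k z‖ ≤ 1 := fun z => by
    rw [Real.norm_eq_abs, Real.abs_exp, Real.exp_le_one_iff]
    have := mul_nonneg hc.le (norm_nonneg ((1 / 2 : ℝ) • z))
    linarith
  have hki : Integrable k :=
    (integrable_exp_neg_mul_norm hc).comp_smul (R := (1 / 2 : ℝ)) (by norm_num)
  have hkx : ∀ x, Integrable (fun y => k (x + y)) := fun x => hki.comp_add_left x
  have hf2' := integrable_norm_sq hf2
  have hku2 : ∀ x, Integrable (fun y => k (x + y) * ‖f y‖ ^ 2) := fun x =>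
    hf2'.bdd_mul (c := 1) (by fun_prop) (Eventually.of_forall fun y => hk1 _)
  have hku : ∀ x, Integrable (fun y => k (x + y) * ‖f y‖) := fun x => by
    refine ((hkx x).add (hku2 x)).mono' ?_ (Eventually.of_forall fun y => ?_)
    · exact (hkc.comp (by fun_prop)).aestronglyMeasurable.mul hf.norm.aestronglyMeasurable
    · have h0 : 0 ≤ k (x + y) := (Real.exp_pos _).le
      rw [Real.norm_of_nonneg (by positivity)]
      simp only [Pi.add_apply]
      nlinarith [mul_nonneg h0 (sq_nonneg (‖f y‖ - 1)), mul_nonneg h0 (sq_nonneg (‖f y‖)), h0]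
  set M : ℝ := |1 / (2 * Real.pi * ħ) ^ 2| * (C * ∫ ξ : Plane, Real.exp (-c * ‖ξ‖)) with hM
  have hbound : ∀ x, ‖weylOp ħ a f x‖ ≤ M * ∫ y, k (x + y) * ‖f y‖ := by
    intro x
    rw [weylOp, norm_mul, Complex.norm_real, Real.norm_eq_abs, hM, mul_assoc |_|]
    refine mul_le_mul_of_nonneg_left ?_ (abs_nonneg (1 / (2 * Real.pi * ħ) ^ 2))
    have hi := ((hku x).mul_prod (integrable_exp_neg_mul_norm hc)).const_mul C
    refine (norm_integral_le_of_norm_le hi (Eventually.of_forall fun p => ?_)).trans_eq ?_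
    · change ‖_‖ ≤ C * (k (x + p.1) * ‖f p.1‖ * Real.exp (-c * ‖p.2‖))
      rw [norm_mul, norm_mul, Complex.norm_exp_ofReal_mul_I, Complex.norm_real, Real.norm_eq_abs,
        mul_one]
      refine (mul_le_mul_of_nonneg_right (a := ‖f p.1‖)
        (hle ((1 / 2 : ℝ) • (x + p.1), p.2)) (norm_nonneg _)).trans_eq ?_
      rw [mul_add, Real.exp_add]
      simp only [hk]
      ring
    · rw [integral_const_mul, integral_prod_mul (fun y => k (x + y) * ‖f y‖)
        (fun ξ : Plane => Real.exp (-c * ‖ξ‖))]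
      ring
  have hF : Integrable (fun x => ∫ y, k (x + y) * ‖f y‖ ^ 2) := by
    have h1 := hki.mul_prod hf2'
    have h2 := (measurePreserving_add_prod (volume : Measure Plane) volume).integrable_comp
      h1.aestronglyMeasurable |>.2 h1
    exact h2.integral_prod_left
  have hkpos : ∀ x, 0 < ∫ y, k (x + y) := fun x => by
    rw [integral_add_left_eq_self k]
    exact integral_exp_pos hki
  rw [memLp_two_iff_integrable_sq_norm hsm.aestronglyMeasurable]
  refine (hF.const_mul (M ^ 2 * ∫ y, k y)).mono' (hsm.norm.pow 2).aestronglyMeasurable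
    (Eventually.of_forall fun x => ?_)
  rw [Real.norm_of_nonneg (by positivity)]
  calc ‖weylOp ħ a f x‖ ^ 2 ≤ (M * ∫ y, k (x + y) * ‖f y‖) ^ 2 := by gcongr; exact hbound x
    _ = M ^ 2 * (∫ y, k (x + y) * ‖f y‖) ^ 2 := by ring
    _ ≤ M ^ 2 * ((∫ y, k (x + y)) * ∫ y, k (x + y) * ‖f y‖ ^ 2) := by
      gcongr
      exact sq_integral_mul_le (fun y => (Real.exp_pos _).le) (hkx x) (hku x) (hku2 x) (hkpos x)
    _ = _ := by rw [integral_add_left_eq_self k]; ring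

/-! ### Parseval's identity for Wigner distributions. -/

open FourierTransform SchwartzMap

/-- Phase space with its Euclidean norm. -/
abbrev EPhase := WithLp 2 (Plane × Plane)

/-- The exponential `exp (2πi r)`. -/
def wave (r : ℝ) : ℂ := Complex.exp ((2 * Real.pi * r : ℝ) * Complex.I)

theorem norm_wave (r : ℝ) : ‖wave r‖ = 1 := Complex.norm_exp_ofReal_mul_I _

theorem continuous_wave : Continuous wave := by unfold wave; fun_prop

theorem wave_add (r s : ℝ) : wave (r + s) = wave r * wave s := by
  rw [wave, wave, wave, ← Complex.exp_add]
  congr 1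
  push_cast
  ring

theorem fourier_eq_wave {V : Type*} [NormedAddCommGroup V] [InnerProductSpace ℝ V]
    [MeasurableSpace V] [BorelSpace V] [FiniteDimensional ℝ V] (g : V → ℂ) (w : V) :
    𝓕 g w = ∫ v, wave (-inner ℝ v w) * g v := by
  rw [Real.fourier_eq']
  simp only [wave, smul_eq_mul]
  refine integral_congr_ae (Eventually.of_forall fun v => ?_)
  simp only
  congr 4
  ring

theorem fourierInv_eq_wave {V : Type*} [NormedAddCommGroup V] [InnerProductSpace ℝ V]
    [MeasurableSpace V] [BorelSpace V] [FiniteDimensional ℝ V] (g : V → ℂ) (w : V) :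
    𝓕⁻ g w = ∫ v, wave (inner ℝ v w) * g v := by
  rw [Real.fourierInv_eq']
  simp only [wave, smul_eq_mul]

theorem schwartz_eq_integral_wave {V : Type*} [NormedAddCommGroup V] [InnerProductSpace ℝ V]
    [MeasurableSpace V] [BorelSpace V] [FiniteDimensional ℝ V] (g : 𝓢(V, ℂ)) (w : V) :
    g w = ∫ v, wave (inner ℝ v w) * (𝓕 g) v := by
  have h := (𝓕 g).integrable (μ := volume)
  rw [SchwartzMap.fourier_coe] at h ⊢
  rw [← fourierInv_eq_wave, g.continuous.fourierInv_fourier_eq g.integrable h]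

theorem integrable_comp_toLp {g : EPhase → ℂ} (hg : Integrable g) :
    Integrable (fun w : Plane × Plane => g (WithLp.toLp 2 w)) :=
  (WithLp.volume_preserving_toLp Plane Plane).integrable_comp_of_integrable hg

theorem integral_comp_toLp (g : EPhase → ℂ) :
    ∫ w : Plane × Plane, g (WithLp.toLp 2 w) = ∫ u, g u :=
  (WithLp.volume_preserving_toLp Plane Plane).integral_comp
    (MeasurableEquiv.toLp 2 (Plane × Plane)).measurableEmbedding g

/-- The decay (1+|u|)⁻³ on phase space dominates the same decay in either variable alone, integrable
since 3 > 2. It serves Fubini and continuity arguments in which only one of the two variables needs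
a majorant. -/
theorem exists_schwartz_bound (g : 𝓢(EPhase, ℂ)) :
    ∃ h : Plane → ℝ, Integrable h ∧
      ∀ x y : Plane, ‖g (WithLp.toLp 2 (x, y))‖ ≤ h x ∧ ‖g (WithLp.toLp 2 (x, y))‖ ≤ h y := by
  have hb := SchwartzMap.one_add_le_sup_seminorm_apply (𝕜 := ℝ) (m := (3, 0)) (k := 3) (n := 0)
    le_rfl le_rfl g
  set C := 2 ^ 3 * ((Finset.Iic (3, 0)).sup fun m => SchwartzMap.seminorm ℝ m.1 m.2) g
  refine ⟨fun x => C * (1 + ‖x‖) ^ (-(3 : ℝ)), Integrable.const_mul (integrable_one_add_norm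
    (by rw [finrank_euclideanSpace_fin]; norm_num)) _, fun x y => ?_⟩
  have key : ∀ r : ℝ, 0 ≤ r → r ≤ ‖(WithLp.toLp 2 (x, y) : EPhase)‖ →
      ‖g (WithLp.toLp 2 (x, y))‖ ≤ C * (1 + r) ^ (-(3 : ℝ)) := by
    intro r hr hle
    have h := hb (WithLp.toLp 2 (x, y))
    rw [norm_iteratedFDeriv_zero] at h
    rw [Real.rpow_neg (by positivity), ← div_eq_mul_inv, le_div_iff₀ (by positivity), mul_comm]
    refine le_trans ?_ h
    rw [show (3 : ℝ) = ((3 : ℕ) : ℝ) by norm_num, Real.rpow_natCast]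
    gcongr
  exact ⟨key _ (norm_nonneg x) (WithLp.norm_fst_le (p := 2) Plane (WithLp.toLp 2 (x, y))),
    key _ (norm_nonneg y) (WithLp.norm_snd_le (p := 2) Plane (WithLp.toLp 2 (x, y)))⟩

theorem continuous_schwartz_toLp (g : 𝓢(EPhase, ℂ)) :
    Continuous (fun w : Plane × Plane => g (WithLp.toLp 2 w)) :=
  g.continuous.comp (WithLp.prod_continuous_toLp 2 Plane Plane)

theorem integrable_schwartz_left (g : 𝓢(EPhase, ℂ)) (y : Plane) :
    Integrable (fun x => g (WithLp.toLp 2 (x, y))) := by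
  obtain ⟨h, hi, hle⟩ := exists_schwartz_bound g
  exact hi.mono' ((continuous_schwartz_toLp g).comp
    (by fun_prop : Continuous fun x : Plane => (x, y))).aestronglyMeasurable
    (Eventually.of_forall fun x => (hle x y).1)

/-- Partial Fourier inversion in the position variable. -/
theorem partial_fourier_inversion (g : 𝓢(EPhase, ℂ)) (x y : Plane) :
    ∫ ξ, wave (-inner ℝ ξ y) * g (WithLp.toLp 2 (x, ξ)) =
      ∫ η, wave (inner ℝ η x) * (𝓕 g) (WithLp.toLp 2 (η, y)) := by
  set β : Plane → ℂ := fun x => ∫ ξ, wave (-inner ℝ ξ y) * g (WithLp.toLp 2 (x, ξ)) with hβ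
  have hprod : Integrable (fun w : Plane × Plane =>
      wave (-inner ℝ w.2 y) * g (WithLp.toLp 2 w)) (volume.prod volume) := by
    refine (integrable_comp_toLp g.integrable).bdd_mul (c := 1) ?_
      (Eventually.of_forall fun w => (norm_wave _).le)
    exact (continuous_wave.comp (by fun_prop)).aestronglyMeasurable
  have hβi : Integrable β := hprod.integral_prod_left
  have hβc : Continuous β := by
    obtain ⟨h, hi, hle⟩ := exists_schwartz_bound g
    have hc : Continuous fun w : Plane × Plane =>
        wave (-inner ℝ w.2 y) * g (WithLp.toLp 2 w) :=
      (continuous_wave.comp (by fun_prop)).mul (continuous_schwartz_toLp g)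
    refine continuous_of_dominated (bound := h) (fun x => ?_) (fun x => ?_) hi ?_
    · exact hc.along_snd.aestronglyMeasurable
    · refine Eventually.of_forall fun ξ => ?_
      rw [norm_mul, norm_wave, one_mul]
      exact (hle x ξ).2
    · exact Eventually.of_forall fun ξ => hc.along_fst
  -- Transforming the partial transform in its remaining variable gives the full transform with
  -- second frequency frozen at y; inversion in that one variable is then pointwise because β is
  -- continuous.
  have hF : 𝓕 β = fun η => (𝓕 g) (WithLp.toLp 2 (η, y)) := by
    ext η
    rw [fourier_eq_wave, SchwartzMap.fourier_coe, fourier_eq_wave, ← integral_comp_toLp]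
    have hp2 : Integrable (fun w : Plane × Plane => wave (-inner ℝ w.1 η) *
        (wave (-inner ℝ w.2 y) * g (WithLp.toLp 2 w))) (volume.prod volume) := by
      refine hprod.bdd_mul (c := 1) ?_ (Eventually.of_forall fun w => (norm_wave _).le)
      exact (continuous_wave.comp (by fun_prop)).aestronglyMeasurable
    have h := integral_prod _ hp2
    simp only [hβ, ← integral_const_mul]
    rw [← h]
    refine integral_congr_ae (Eventually.of_forall fun w => ?_)
    simp only [WithLp.prod_inner_apply, neg_add, wave_add]
    ring
  have := hβc.fourierInv_fourier_eq hβi (hF ▸ integrable_schwartz_left (𝓕 g) y)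
  rw [hF] at this
  have hx := congrFun this x
  rw [fourierInv_eq_wave] at hx
  exact hx.symm

theorem ambig_eq_corr (f : Plane → ℂ) (v q : Plane) :
    ambig f ((1 / 2 : ℝ) • v) q =
      ∫ s, corr f s v * Complex.exp ((inner ℝ q s : ℝ) * Complex.I) := rfl

theorem norm_ambig_le (hf : StronglyMeasurable f) (hf2 : MemLp f 2 volume) (p q : Plane) :
    ‖ambig f p q‖ ≤ ∫ x, ‖f x‖ ^ 2 := by
  have e : p = (1 / 2 : ℝ) • ((2 : ℝ) • p) := by rw [smul_smul]; norm_num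
  rw [e, ambig_eq_corr]
  refine (norm_integral_le_integral_norm _).trans ?_
  simp only [norm_mul, Complex.norm_exp_ofReal_mul_I, mul_one]
  exact (integrable_corr_left hf hf2 _).2

theorem stronglyMeasurable_ambig (hf : StronglyMeasurable f) :
    StronglyMeasurable (fun w : Plane × Plane => ambig f w.1 w.2) := by
  refine StronglyMeasurable.integral_prod_right' (f := fun z : (Plane × Plane) × Plane =>
    f (z.2 + z.1.1) * starRingEnd ℂ (f (z.2 - z.1.1)) *
      Complex.exp ((inner ℝ z.1.2 z.2 : ℝ) * Complex.I)) ?_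
  have h1 : StronglyMeasurable (fun z : (Plane × Plane) × Plane => f (z.2 + z.1.1)) :=
    hf.comp_measurable (by fun_prop)
  have h2 : StronglyMeasurable (fun z : (Plane × Plane) × Plane => f (z.2 - z.1.1)) :=
    hf.comp_measurable (by fun_prop)
  exact (h1.mul (Complex.continuous_conj.comp_stronglyMeasurable h2)).mul
    (Continuous.stronglyMeasurable (by fun_prop))

/-- The characteristic function of the Wigner distribution. -/
def wignerChar (ħ : ℝ) (f : Plane → ℂ) (u : EPhase) : ℂ :=
  ambig f ((Real.pi * ħ) • u.ofLp.2) ((2 * Real.pi) • u.ofLp.1)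

theorem stronglyMeasurable_wignerChar (ħ : ℝ) (hf : StronglyMeasurable f) :
    StronglyMeasurable (wignerChar ħ f) :=
  (stronglyMeasurable_ambig hf).comp_measurable
    (g := fun u : EPhase => ((Real.pi * ħ) • u.ofLp.2, (2 * Real.pi) • u.ofLp.1)) (by fun_prop)

/-- With v = 2πħy the phase becomes exp(-2πi⟨ξ, y⟩), so the ξ-integral is a partial Fourier
transform of g. Inverting it in position and exchanging X with η leaves the X-integral of the
correlation, which is the ambiguity function. -/
theorem integral_schwartz_mul_corr_mul_phase {ħ : ℝ} (hh : 0 < ħ) (hf : StronglyMeasurable f)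
    (hf2 : MemLp f 2 volume) (g : 𝓢(EPhase, ℂ)) (y : Plane) :
    ∫ w : PhaseSpace, g (WithLp.toLp 2 w) * (corr f w.1 ((2 * Real.pi * ħ) • y) *
        phase ħ ((2 * Real.pi * ħ) • y) w.2) =
      ∫ η : Plane, (𝓕 g) (WithLp.toLp 2 (η, y)) * wignerChar ħ f (WithLp.toLp 2 (η, y)) := by
  set v := (2 * Real.pi * ħ) • y with hv
  have hph : ∀ ξ : Plane, phase ħ v ξ = wave (-inner ℝ ξ y) := by
    intro ξ
    rw [phase, wave, hv, inner_smul_left, real_inner_comm]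
    congr 2
    rw [← Complex.ofReal_neg]
    congr 1
    simp
    field_simp
  have hcorr := (integrable_corr_left hf hf2 v).1
  have hcm : StronglyMeasurable (fun X => corr f X v) :=
    (stronglyMeasurable_corr hf).comp_measurable (measurable_prodMk_right (y := v))
  have hch : ∀ η : Plane, wignerChar ħ f (WithLp.toLp 2 (η, y)) =
      ∫ X, corr f X v * wave (inner ℝ η X) := by
    intro η
    rw [wignerChar]
    have e : (Real.pi * ħ) • (WithLp.toLp 2 (η, y) : EPhase).ofLp.2 = (1 / 2 : ℝ) • v := by
      rw [hv, smul_smul]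
      congr 1
      ring
    rw [e, ambig_eq_corr]
    simp only [wave, inner_smul_left]
    rfl
  obtain ⟨h, hi, hle⟩ := exists_schwartz_bound g
  have hint : Integrable (fun w : Plane × Plane => g (WithLp.toLp 2 w) *
      (corr f w.1 v * phase ħ v w.2)) (volume.prod volume) := by
    have hdom := hcorr.norm.mul_prod hi
    refine hdom.mono' ?_ (Eventually.of_forall fun w => ?_)
    · refine (continuous_schwartz_toLp g).aestronglyMeasurable.mul (AEStronglyMeasurable.mul ?_ ?_)
      · exact (hcm.comp_measurable measurable_fst).aestronglyMeasurable
      · refine Continuous.aestronglyMeasurable ?_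
        unfold phase; fun_prop
    · rw [norm_mul, norm_mul, norm_phase, mul_one, mul_comm]
      gcongr
      exact (hle w.1 w.2).2
  have hint2 : Integrable (fun w : Plane × Plane => (corr f w.1 v *
      (wave (inner ℝ w.2 w.1) * (𝓕 g) (WithLp.toLp 2 (w.2, y))))) (volume.prod volume) := by
    have h1 := hcorr.mul_prod (integrable_schwartz_left (𝓕 g) y)
    have h2 := h1.bdd_mul (c := 1) (f := fun w : Plane × Plane => wave (inner ℝ w.2 w.1))
      (continuous_wave.comp (by fun_prop)).aestronglyMeasurable
      (Eventually.of_forall fun w => (norm_wave _).le)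
    refine h2.congr (Eventually.of_forall fun w => ?_)
    simp only
    ring
  have s1 := integral_prod _ hint
  refine s1.trans ?_
  have s2 : ∀ X : Plane, ∫ ξ : Plane, g (WithLp.toLp 2 (X, ξ)) *
      (corr f X v * phase ħ v ξ) =
      ∫ η : Plane, corr f X v * (wave (inner ℝ η X) * (𝓕 g) (WithLp.toLp 2 (η, y))) := by
    intro X
    rw [integral_const_mul, ← partial_fourier_inversion, ← integral_const_mul]
    refine integral_congr_ae (Eventually.of_forall fun ξ => ?_)
    simp only [hph]
    ring
  simp only [s2]
  rw [integral_integral_swap hint2]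
  refine integral_congr_ae (Eventually.of_forall fun η => ?_)
  simp only [hch]
  rw [← integral_const_mul]
  refine integral_congr_ae (Eventually.of_forall fun X => ?_)
  simp only
  ring

/-- Parseval's identity for the Wigner distribution against a Schwartz symbol. -/
theorem integral_schwartz_mul_wigner {ħ : ℝ} (hh : 0 < ħ) (hf : StronglyMeasurable f)
    (hf2 : MemLp f 2 volume) (g : 𝓢(EPhase, ℂ)) :
    ∫ w : PhaseSpace, g (WithLp.toLp 2 w) * wigner ħ f w = ∫ u, (𝓕 g) u * wignerChar ħ f u := by
  have hgi : Integrable (fun w : PhaseSpace => g (WithLp.toLp 2 w)) :=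
    integrable_comp_toLp g.integrable
  rw [integral_mul_wigner_eq ħ hf hf2 hgi]
  have h1 := integral_prod_symm _ (integrable_mul_corr_mul_phase ħ hf hf2 hgi)
  have h2 : ∫ u, (𝓕 g) u * wignerChar ħ f u = ∫ y : Plane, ∫ η : Plane,
      (𝓕 g) (WithLp.toLp 2 (η, y)) * wignerChar ħ f (WithLp.toLp 2 (η, y)) := by
    have hi : Integrable (fun u => (𝓕 g) u * wignerChar ħ f u) :=
      (𝓕 g).integrable.mul_bdd (stronglyMeasurable_wignerChar ħ hf).aestronglyMeasurable
        (Eventually.of_forall fun u => norm_ambig_le hf hf2 _ _)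
    rw [← integral_comp_toLp (fun u => (𝓕 g : 𝓢(EPhase, ℂ)) u * wignerChar ħ f u)]
    exact integral_prod_symm _ (integrable_comp_toLp hi)
  rw [h2]
  -- The Jacobian (2πħ)² of v = 2πħy cancels the Wigner prefactor.
  have h3 := Measure.integral_comp_smul (volume : Measure Plane) (fun v : Plane =>
    ∫ w : PhaseSpace, g (WithLp.toLp 2 w) * (corr f w.1 v * phase ħ v w.2)) (2 * Real.pi * ħ)
  simp only [integral_schwartz_mul_corr_mul_phase hh hf hf2 g] at h3
  rw [h3, finrank_euclideanSpace_fin, abs_of_pos (by positivity), Complex.real_smul]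
  refine (congrArg _ h1).trans ?_
  congr 2
  field_simp
  norm_num

/-! ### The unitary action on phase space -/

/-- The complex coordinates `z = x + i ξ` of phase space. -/
def zCoord (w : PhaseSpace) (k : Fin 2) : ℂ := (w.1 k : ℂ) + Complex.I * (w.2 k : ℂ)

theorem zCoord_re (w : PhaseSpace) (k : Fin 2) : (zCoord w k).re = w.1 k := by simp [zCoord]

theorem zCoord_im (w : PhaseSpace) (k : Fin 2) : (zCoord w k).im = w.2 k := by simp [zCoord]

theorem zCoord_injective : Function.Injective zCoord := by
  intro w w' h
  refine Prod.ext ?_ ?_ <;> ext k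
  · rw [← zCoord_re, h, zCoord_re]
  · rw [← zCoord_im, h, zCoord_im]

theorem zCoord_matrixAct (U : Matrix (Fin 2) (Fin 2) ℂ) (w : PhaseSpace) :
    zCoord (matrixAct U w) = U.mulVec (zCoord w) := by
  ext k
  apply Complex.ext
  · rw [zCoord_re]; rfl
  · rw [zCoord_im]; rfl

theorem zCoord_add (w w' : PhaseSpace) : zCoord (w + w') = zCoord w + zCoord w' := by
  ext k; simp [zCoord]; ring

theorem zCoord_smul (r : ℝ) (w : PhaseSpace) : zCoord (r • w) = (r : ℂ) • zCoord w := by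
  ext k; simp [zCoord]; ring

theorem matrixAct_add (U : Matrix (Fin 2) (Fin 2) ℂ) (w w' : PhaseSpace) :
    matrixAct U (w + w') = matrixAct U w + matrixAct U w' := by
  apply zCoord_injective
  simp only [zCoord_matrixAct, zCoord_add, Matrix.mulVec_add]

theorem matrixAct_smul (U : Matrix (Fin 2) (Fin 2) ℂ) (r : ℝ) (w : PhaseSpace) :
    matrixAct U (r • w) = r • matrixAct U w := by
  apply zCoord_injective
  simp only [zCoord_matrixAct, zCoord_smul, Matrix.mulVec_smul]

/-- Multiplication by `i` on phase space. -/
def rotate (w : PhaseSpace) : PhaseSpace := (-w.2, w.1)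

theorem zCoord_rotate (w : PhaseSpace) : zCoord (rotate w) = Complex.I • zCoord w := by
  ext k
  simp only [zCoord, rotate, Pi.smul_apply, smul_eq_mul, PiLp.neg_apply, Complex.ofReal_neg]
  ring_nf
  simp

theorem matrixAct_rotate (U : Matrix (Fin 2) (Fin 2) ℂ) (w : PhaseSpace) :
    matrixAct U (rotate w) = rotate (matrixAct U w) := by
  apply zCoord_injective
  simp only [zCoord_matrixAct, zCoord_rotate, Matrix.mulVec_smul]

theorem norm_sq_toLp_eq (w : PhaseSpace) :
    ((‖(WithLp.toLp 2 w : EPhase)‖ ^ 2 : ℝ) : ℂ) = star (zCoord w) ⬝ᵥ zCoord w := by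
  have h : ∀ k, star (zCoord w k) * zCoord w k = ((w.1 k ^ 2 + w.2 k ^ 2 : ℝ) : ℂ) := by
    intro k
    rw [mul_comm, ← starRingEnd_apply, Complex.mul_conj, Complex.normSq_apply, zCoord_re,
      zCoord_im]
    push_cast
    ring
  simp only [dotProduct, Pi.star_apply, h, Fin.sum_univ_two]
  rw [WithLp.prod_norm_sq_eq_of_L2, EuclideanSpace.norm_sq_eq, EuclideanSpace.norm_sq_eq]
  simp only [Fin.sum_univ_two, Real.norm_eq_abs, sq_abs, WithLp.toLp_fst, WithLp.toLp_snd]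
  push_cast
  ring

theorem norm_matrixAct {U : Matrix (Fin 2) (Fin 2) ℂ} (hU : U ∈ Matrix.unitaryGroup (Fin 2) ℂ)
    (w : PhaseSpace) :
    ‖(WithLp.toLp 2 (matrixAct U w) : EPhase)‖ = ‖(WithLp.toLp 2 w : EPhase)‖ := by
  have h : ((‖(WithLp.toLp 2 (matrixAct U w) : EPhase)‖ ^ 2 : ℝ) : ℂ) =
      ((‖(WithLp.toLp 2 w : EPhase)‖ ^ 2 : ℝ) : ℂ) := by
    rw [norm_sq_toLp_eq, norm_sq_toLp_eq, zCoord_matrixAct, Matrix.star_mulVec,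
      ← Matrix.dotProduct_mulVec, Matrix.mulVec_mulVec]
    have : U.conjTranspose * U = 1 := (Matrix.mem_unitaryGroup_iff').1 hU
    rw [this, Matrix.one_mulVec]
  have h' : ‖(WithLp.toLp 2 (matrixAct U w) : EPhase)‖ ^ 2 =
      ‖(WithLp.toLp 2 w : EPhase)‖ ^ 2 := by exact_mod_cast h
  rwa [sq_eq_sq₀ (norm_nonneg _) (norm_nonneg _)] at h'

/-- A unitary matrix acts on phase space by a linear isometry. -/
def unitaryAct (U : Matrix (Fin 2) (Fin 2) ℂ) (hU : U ∈ Matrix.unitaryGroup (Fin 2) ℂ) :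
    EPhase ≃ₗᵢ[ℝ] EPhase :=
  LinearIsometry.toLinearIsometryEquiv
    { toFun := fun u => WithLp.toLp 2 (matrixAct U u.ofLp)
      map_add' := fun u v => by rw [WithLp.ofLp_add, matrixAct_add, WithLp.toLp_add]
      map_smul' := fun r u => by
        rw [WithLp.ofLp_smul, matrixAct_smul, WithLp.toLp_smul, RingHom.id_apply]
      norm_map' := fun u => norm_matrixAct hU u.ofLp } rfl

variable {U : Matrix (Fin 2) (Fin 2) ℂ}

theorem unitaryAct_apply (hU : U ∈ Matrix.unitaryGroup (Fin 2) ℂ) (u : EPhase) :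
    unitaryAct U hU u = WithLp.toLp 2 (matrixAct U u.ofLp) := rfl

theorem measurePreserving_of_isometry (A : EPhase ≃ₗᵢ[ℝ] EPhase) :
    MeasurePreserving (fun w : PhaseSpace => (A (WithLp.toLp 2 w)).ofLp) :=
  (WithLp.volume_preserving_ofLp Plane Plane).comp
    (A.measurePreserving.comp (WithLp.volume_preserving_toLp Plane Plane))

theorem measurableEmbedding_of_isometry (A : EPhase ≃ₗᵢ[ℝ] EPhase) :
    MeasurableEmbedding (fun w : PhaseSpace => (A (WithLp.toLp 2 w)).ofLp) :=
  (MeasurableEquiv.toLp 2 (Plane × Plane)).symm.measurableEmbedding.comp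
    (A.toHomeomorph.measurableEmbedding.comp
      (MeasurableEquiv.toLp 2 (Plane × Plane)).measurableEmbedding)

theorem integral_comp_isometry (A : EPhase ≃ₗᵢ[ℝ] EPhase) (F : PhaseSpace → ℂ) :
    ∫ w : PhaseSpace, F (A (WithLp.toLp 2 w)).ofLp = ∫ w, F w :=
  (measurePreserving_of_isometry A).integral_comp (measurableEmbedding_of_isometry A) F

theorem integral_comp_matrixAct (hU : U ∈ Matrix.unitaryGroup (Fin 2) ℂ) (F : PhaseSpace → ℂ) :
    ∫ w, F (matrixAct U w) = ∫ w, F w :=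
  integral_comp_isometry (unitaryAct U hU) F

/-! ### Metaplectic covariance -/

/-- Shifting x by x₀/2 symmetrizes the product, and the half-phase -⟨ξ₀, x₀⟩/2 in the translation
cancels exactly. -/
theorem inner_heisenberg {ħ : ℝ} (φ : L2Plane) (w : PhaseSpace) :
    inner ℂ φ (heisenberg ħ w φ) = ambig φ (-(1 / 2 : ℝ) • w.1) ((1 / ħ) • w.2) := by
  rw [L2.inner_def]
  have h1 : (heisenberg ħ w φ : Plane → ℂ) =ᵐ[volume] heisenbergFun ħ w φ :=
    (memLp_heisenbergFun ħ w φ).coeFn_toLp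
  have h2 : ∫ x, inner ℂ ((φ : Plane → ℂ) x) ((heisenberg ħ w φ : Plane → ℂ) x) =
      ∫ x, heisenbergFun ħ w φ x * starRingEnd ℂ ((φ : Plane → ℂ) x) := by
    refine integral_congr_ae ?_
    filter_upwards [h1] with x hx
    rw [hx, RCLike.inner_apply]
  rw [h2, ← integral_add_right_eq_self _ ((1 / 2 : ℝ) • w.1), ambig]
  refine integral_congr_ae (Eventually.of_forall fun x => ?_)
  have e1 : x + (1 / 2 : ℝ) • w.1 - w.1 = x + -(1 / 2 : ℝ) • w.1 := by module
  have e2 : x - -(1 / 2 : ℝ) • w.1 = x + (1 / 2 : ℝ) • w.1 := by module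
  simp only [heisenbergFun]
  rw [e1, e2]
  have e3 : (inner ℝ w.2 (x + (1 / 2 : ℝ) • w.1) - inner ℝ w.2 w.1 / 2) / ħ =
      inner ℝ ((1 / ħ) • w.2) x := by
    rw [inner_add_right, inner_smul_right, inner_smul_left]
    simp
    ring
  rw [e3]
  ring

/-- A frequency u corresponds to the translation by 2πħ·iu: `rotate` is the symplectic structure
relating phase-space characters to translations. -/
theorem wignerChar_eq_inner {ħ : ℝ} (hh : 0 < ħ) (φ : L2Plane) (u : EPhase) :
    wignerChar ħ φ u = inner ℂ φ (heisenberg ħ ((2 * Real.pi * ħ) • rotate u.ofLp) φ) := by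
  rw [inner_heisenberg, wignerChar]
  congr 1
  · simp only [rotate, Prod.smul_fst, smul_neg, smul_smul, ← neg_smul]
    congr 1
    ring
  · simp only [rotate, Prod.smul_snd, smul_smul]
    congr 1
    field_simp

/-- Complex linearity lets U commute with multiplication by i; the intertwining relation then
carries the translation through T, and unitarity removes T from the inner product. The metaplectic
relation enters the argument here. -/
theorem wignerChar_metaplectic {ħ : ℝ} (hh : 0 < ħ) (hU : U ∈ Matrix.unitaryGroup (Fin 2) ℂ)
    {T : L2Plane ≃ₗᵢ[ℂ] L2Plane} (hT : IsMetaplectic ħ (matrixAct U) T) (φ : L2Plane)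
    (u : EPhase) :
    wignerChar ħ (T φ) (unitaryAct U hU u) = wignerChar ħ φ u := by
  rw [wignerChar_eq_inner hh, wignerChar_eq_inner hh, unitaryAct_apply]
  simp only
  rw [← matrixAct_rotate, ← matrixAct_smul, ← hT, LinearIsometryEquiv.inner_map_map]

theorem stronglyMeasurable_coe (φ : L2Plane) : StronglyMeasurable (φ : Plane → ℂ) :=
  Lp.stronglyMeasurable φ

/-- Covariance of the Wigner distribution, tested against Schwartz symbols. -/
theorem integral_schwartz_mul_wigner_metaplectic {ħ : ℝ} (hh : 0 < ħ)
    (hU : U ∈ Matrix.unitaryGroup (Fin 2) ℂ)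
    {T : L2Plane ≃ₗᵢ[ℂ] L2Plane} (hT : IsMetaplectic ħ (matrixAct U) T) (φ : L2Plane)
    (g : 𝓢(EPhase, ℂ)) :
    ∫ w : PhaseSpace, g (WithLp.toLp 2 w) * wigner ħ (T φ) w =
      ∫ w : PhaseSpace, g (WithLp.toLp 2 (matrixAct U w)) * wigner ħ φ w := by
  set A := unitaryAct U hU with hA
  set gA : 𝓢(EPhase, ℂ) :=
    SchwartzMap.compCLMOfContinuousLinearEquiv ℂ A.toContinuousLinearEquiv g with hgA
  have hgA' : ∀ u, gA u = g (A u) := fun u => rfl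
  -- The Fourier transform commutes with linear isometries, and U acts as one for the Euclidean
  -- norm.
  have hF : ∀ u, (𝓕 gA : 𝓢(EPhase, ℂ)) u = (𝓕 g : 𝓢(EPhase, ℂ)) (A u) := by
    intro u
    rw [SchwartzMap.fourier_coe, SchwartzMap.fourier_coe, ← Real.fourier_comp_linearIsometry]
    rfl
  have h1 := integral_schwartz_mul_wigner hh (stronglyMeasurable_coe φ) (Lp.memLp φ) gA
  have h2 := integral_schwartz_mul_wigner hh (stronglyMeasurable_coe (T φ)) (Lp.memLp (T φ)) g
  rw [h2]
  refine Eq.trans ?_ h1.symm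
  rw [← A.measurePreserving.integral_comp A.toHomeomorph.measurableEmbedding]
  refine integral_congr_ae (Eventually.of_forall fun u => ?_)
  simp only [hF]
  rw [hA, wignerChar_metaplectic hh hU hT]

/-- Covariance of the Wigner distribution under metaplectic operators. -/
theorem wigner_metaplectic_ae {ħ : ℝ} (hh : 0 < ħ) (hU : U ∈ Matrix.unitaryGroup (Fin 2) ℂ)
    {T : L2Plane ≃ₗᵢ[ℂ] L2Plane} (hT : IsMetaplectic ħ (matrixAct U) T) (φ : L2Plane) :
    ∀ᵐ w : PhaseSpace, wigner ħ (T φ) (matrixAct U w) = wigner ħ φ w := by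
  set A := unitaryAct U hU with hA
  have hm := measurePreserving_of_isometry A
  have hloc : LocallyIntegrable (fun w => wigner ħ (T φ) (matrixAct U w)) :=
    (locallyIntegrable_const (|1 / (4 * Real.pi ^ 2 * ħ ^ 2)| *
      (4 * ∫ x, ‖(T φ : Plane → ℂ) x‖ ^ 2))).mono
      ((stronglyMeasurable_wigner ħ (stronglyMeasurable_coe (T φ))).comp_measurable
        hm.measurable).aestronglyMeasurable
      (Eventually.of_forall fun w => (norm_wigner_le ħ (stronglyMeasurable_coe (T φ))
        (Lp.memLp (T φ)) _).trans (le_abs_self _))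
  -- Locally integrable functions agreeing against all compactly supported smooth g agree a.e.; each
  -- g is transported by the inverse isometry to become the Schwartz symbol of the covariance
  -- identity.
  refine ae_eq_of_integral_contDiff_smul_eq hloc
    (locallyIntegrable_wigner ħ (stronglyMeasurable_coe φ) (Lp.memLp φ)) fun g hg hgc => ?_
  have hcd : ContDiff ℝ ∞ (fun u : EPhase => ((g (A.symm u).ofLp : ℝ) : ℂ)) :=
    Complex.ofRealCLM.contDiff.comp (hg.comp
      ((WithLp.prodContinuousLinearEquiv 2 ℝ Plane Plane).contDiff.comp
        A.symm.toContinuousLinearEquiv.contDiff))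
  have hcs : HasCompactSupport (fun u : EPhase => ((g (A.symm u).ofLp : ℝ) : ℂ)) := by
    have h1 : HasCompactSupport (fun u : EPhase => g (A.symm u).ofLp) :=
      hgc.comp_homeomorph (A.symm.toHomeomorph.trans
        (WithLp.prodContinuousLinearEquiv 2 ℝ Plane Plane).toHomeomorph)
    exact h1.comp_left (g := fun r : ℝ => (r : ℂ)) Complex.ofReal_zero
  have h := integral_schwartz_mul_wigner_metaplectic hh hU hT φ (hcs.toSchwartzMap hcd)
  have e1 : ∀ u, hcs.toSchwartzMap hcd u = ((g (A.symm u).ofLp : ℝ) : ℂ) := fun u => rfl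
  simp only [e1] at h
  have e2 : ∀ w : PhaseSpace, A.symm (WithLp.toLp 2 (matrixAct U w)) = WithLp.toLp 2 w := by
    intro w
    rw [LinearIsometryEquiv.symm_apply_eq, hA, unitaryAct_apply]
  rw [← integral_comp_matrixAct hU] at h
  simp only [e2] at h
  simpa only [Complex.real_smul] using h

/-- Almost-everywhere covariance frees the identity from Schwartz symbols. -/
theorem integral_mul_wigner_metaplectic {ħ : ℝ} (hh : 0 < ħ)
    (hU : U ∈ Matrix.unitaryGroup (Fin 2) ℂ)
    {T : L2Plane ≃ₗᵢ[ℂ] L2Plane} (hT : IsMetaplectic ħ (matrixAct U) T) (φ : L2Plane)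
    (a : PhaseSpace → ℂ) :
    ∫ w, a w * wigner ħ (T φ) w = ∫ w, a (matrixAct U w) * wigner ħ φ w := by
  rw [← integral_comp_matrixAct hU]
  refine integral_congr_ae ?_
  filter_upwards [wigner_metaplectic_ae hh hU hT φ] with w hw
  rw [hw]

/-! ### The Bessel function -/

/-- The series `∑ (-s)^j / (j!)²`, i.e. the Bessel function `J₀(2√s)`. -/
def besselSeries (s : ℝ) : ℝ := ∑' j : ℕ, (-s) ^ j / (j.factorial : ℝ) ^ 2

theorem laguerre_eq_tsum (N : ℕ) (r : ℝ) :
    laguerre N r = ∑' j : ℕ, (N.choose j : ℝ) * (-r) ^ j / j.factorial := by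
  rw [laguerre, tsum_eq_sum]
  intro j hj
  rw [Nat.choose_eq_zero_of_lt (by simpa [Finset.mem_range, Nat.lt_succ_iff] using hj)]
  simp

/-- The Mehler–Heine asymptotics of the Laguerre polynomials. -/
theorem tendsto_laguerre_div (s : ℝ) :
    Tendsto (fun N : ℕ => laguerre N (s / (N + 1))) atTop (𝓝 (besselSeries s)) := by
  simp only [laguerre_eq_tsum, besselSeries]
  refine tendsto_tsum_of_dominated_convergence (bound := fun j => |s| ^ j / j.factorial)
    (Real.summable_pow_div_factorial |s|) (fun j => ?_)
    (Eventually.of_forall fun N j => ?_)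
  -- Termwise limit from C(N, j) ~ N^j/j!; the domination below uses C(N, j) ≤ (N+1)^j, which
  -- cancels the scaling of the argument.
  · have h1 : Tendsto (fun N : ℕ => (N.choose j : ℝ) / ((N : ℝ) ^ j / j.factorial)) atTop (𝓝 1) := by
      refine (Asymptotics.isEquivalent_iff_tendsto_one ?_).1 (isEquivalent_choose j)
      filter_upwards [eventually_gt_atTop 0] with N hN
      have : (0 : ℝ) < N := by exact_mod_cast hN
      positivity
    have h2 : Tendsto (fun N : ℕ => ((N : ℝ) / (N + 1)) ^ j) atTop (𝓝 1) := by
      simpa using (tendsto_natCast_div_add_atTop (1 : ℝ)).pow j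
    have h3 := ((h1.mul h2).mul_const ((-s) ^ j / (j.factorial : ℝ) ^ 2))
    rw [one_mul, one_mul] at h3
    refine h3.congr' ?_
    filter_upwards [eventually_gt_atTop 0] with N hN
    have : (0 : ℝ) < N := by exact_mod_cast hN
    have hj : (j.factorial : ℝ) ≠ 0 := by exact_mod_cast j.factorial_ne_zero
    rw [div_pow, ← neg_div, div_pow]
    field_simp
  · rw [norm_div, norm_mul, norm_pow, norm_neg, norm_div, Real.norm_natCast, Real.norm_natCast,
      Real.norm_eq_abs, Real.norm_eq_abs, abs_of_pos (by positivity : (0 : ℝ) < N + 1)]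
    gcongr
    have h1 : (N.choose j : ℝ) ≤ (N + 1) ^ j := by
      calc (N.choose j : ℝ) ≤ N ^ j := by exact_mod_cast Nat.choose_le_pow N j
        _ ≤ _ := by gcongr; linarith
    rw [div_pow, ← mul_div_assoc, div_le_iff₀ (by positivity), mul_comm]
    gcongr

theorem integral_exp_int_mul (m n : ℕ) :
    ∫ t in (0 : ℝ)..(2 * Real.pi), Complex.exp (((m : ℂ) - n) * Complex.I * t) =
      if m = n then 2 * Real.pi else 0 := by
  split_ifs with h
  · subst h
    simp
  · have hc : ((m : ℂ) - n) * Complex.I ≠ 0 :=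
      mul_ne_zero (sub_ne_zero.2 (by exact_mod_cast h)) Complex.I_ne_zero
    rw [integral_exp_mul_complex hc]
    have : ((m : ℂ) - n) * Complex.I * ((2 * Real.pi : ℝ) : ℂ) =
        ((m - n : ℤ) : ℂ) * (2 * Real.pi * Complex.I) := by
      push_cast; ring
    rw [this, Complex.exp_int_mul_two_pi_mul_I]
    simp

theorem complex_hasSum_exp (z : ℂ) : HasSum (fun n : ℕ => z ^ n / n.factorial) (Complex.exp z) := by
  rw [Complex.exp_eq_exp_ℂ]
  exact NormedSpace.expSeries_div_hasSum_exp z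

/-- Expand both exponentials into a double series; integrating e^{i(m-n)t} over a period kills every
off-diagonal term. -/
theorem integral_exp_circle (α β : ℂ) :
    HasSum (fun j : ℕ => (α * β) ^ j / (j.factorial : ℂ) ^ 2 * (2 * Real.pi))
      (∫ t in (0 : ℝ)..(2 * Real.pi), Complex.exp (α * Complex.exp (t * Complex.I) +
        β * Complex.exp (-(t * Complex.I)))) := by
  set F : ℕ × ℕ → ℝ → ℂ := fun p t => (α ^ p.1 / p.1.factorial) * (β ^ p.2 / p.2.factorial) *
    Complex.exp (((p.1 : ℂ) - p.2) * Complex.I * t) with hF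
  have hb : Summable (fun p : ℕ × ℕ =>
      (‖α‖ ^ p.1 / (p.1.factorial : ℝ)) * (‖β‖ ^ p.2 / (p.2.factorial : ℝ))) :=
    (Real.summable_pow_div_factorial ‖α‖).mul_of_nonneg (Real.summable_pow_div_factorial ‖β‖)
      (fun n => by positivity) (fun n => by positivity)
  have hn : ∀ p t, ‖F p t‖ ≤
      (‖α‖ ^ p.1 / (p.1.factorial : ℝ)) * (‖β‖ ^ p.2 / (p.2.factorial : ℝ)) := by
    intro p t
    have e : ((p.1 : ℂ) - p.2) * Complex.I * t = (((p.1 : ℝ) - p.2) * t : ℝ) * Complex.I := by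
      push_cast; ring
    simp only [hF]
    rw [norm_mul, e, Complex.norm_exp_ofReal_mul_I, mul_one, norm_mul, norm_div, norm_div,
      norm_pow, norm_pow, Complex.norm_natCast, Complex.norm_natCast]
  have hs : ∀ t : ℝ, HasSum (fun p => F p t) (Complex.exp (α * Complex.exp (t * Complex.I) +
      β * Complex.exp (-(t * Complex.I)))) := by
    intro t
    have e : ∀ p : ℕ × ℕ, F p t = ((α * Complex.exp (t * Complex.I)) ^ p.1 / p.1.factorial) *
        ((β * Complex.exp (-(t * Complex.I))) ^ p.2 / p.2.factorial) := by
      intro p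
      have e2 : Complex.exp (((p.1 : ℂ) - p.2) * Complex.I * t) =
          Complex.exp (t * Complex.I) ^ p.1 * Complex.exp (-(t * Complex.I)) ^ p.2 := by
        rw [← Complex.exp_nat_mul, ← Complex.exp_nat_mul, ← Complex.exp_add]
        congr 1
        ring
      simp only [hF]
      rw [e2, mul_pow, mul_pow]
      ring
    rw [Complex.exp_add]
    refine ((complex_hasSum_exp _).mul (complex_hasSum_exp _) ?_).congr_fun ?_
    · exact (hb.of_norm_bounded (fun p => hn p t)).congr (fun p => e p)
    · exact e
  have h := intervalIntegral.hasSum_integral_of_dominated_convergence (μ := volume) (a := 0)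
    (b := 2 * Real.pi) (F := F) (fun p _ =>
      (‖α‖ ^ p.1 / (p.1.factorial : ℝ)) * (‖β‖ ^ p.2 / (p.2.factorial : ℝ)))
    (fun p => Continuous.aestronglyMeasurable (by fun_prop))
    (fun p => Eventually.of_forall fun t _ => hn p t) (Eventually.of_forall fun t _ => hb)
    (by simp) (Eventually.of_forall fun t _ => hs t)
  have hdiag : Function.Injective (fun j : ℕ => (j, j)) := fun i j hij => (Prod.mk.inj hij).1
  have hv : ∀ p : ℕ × ℕ, ∫ t in (0 : ℝ)..(2 * Real.pi), F p t =
      (α ^ p.1 / p.1.factorial) * (β ^ p.2 / p.2.factorial) *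
        if p.1 = p.2 then 2 * (Real.pi : ℂ) else 0 := by
    intro p
    simp only [hF]
    rw [intervalIntegral.integral_const_mul, integral_exp_int_mul]
    congr 1
    split_ifs <;> simp
  simp only [hv] at h
  rw [← hdiag.hasSum_iff] at h
  · refine h.congr_fun fun j => ?_
    simp only [Function.comp_apply, if_true]
    rw [mul_pow]
    ring
  · intro p hp
    have : p.1 ≠ p.2 := fun hpp => hp ⟨p.1, Prod.ext rfl hpp⟩
    simp [this]

/-- The Fourier transform of the uniform measure on the reference orbit. -/
theorem integral_wave_referenceOrbit {E : ℝ} (hE : 0 < E) (u : EPhase) :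
    ∫ t in (0 : ℝ)..(2 * Real.pi), wave (inner ℝ u (WithLp.toLp 2 (referenceOrbit E t))) =
      2 * Real.pi * (besselSeries (Real.pi ^ 2 * E *
        ‖cplx u.ofLp.2 + Complex.I * cplx u.ofLp.1‖ ^ 2) : ℝ) := by
  set η := u.ofLp.1 with hη
  set y := u.ofLp.2 with hy
  -- K is chosen so that ⟨u, γ₀(t)⟩ = √E Re(K̄ e^{it}); with c = iπ√E the wave becomes exp(cK̄e^{it}
  -- + cKe^{-it}), and c² = -π²E supplies the sign of the Bessel series.
  set K : ℂ := ((η 0 + y 1 : ℝ) : ℂ) + ((η 1 - y 0 : ℝ) : ℂ) * Complex.I with hK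
  set c : ℂ := Complex.I * (Real.pi * √E : ℝ) with hc
  have hwave : ∀ t : ℝ, wave (inner ℝ u (WithLp.toLp 2 (referenceOrbit E t))) =
      Complex.exp (c * starRingEnd ℂ K * Complex.exp (t * Complex.I) +
        c * K * Complex.exp (-(t * Complex.I))) := by
    intro t
    rw [wave, WithLp.prod_inner_apply]
    congr 1
    rw [← neg_mul, ← Complex.ofReal_neg, Complex.exp_mul_I, Complex.exp_mul_I,
      ← Complex.ofReal_cos, ← Complex.ofReal_sin, ← Complex.ofReal_cos, ← Complex.ofReal_sin,
      Real.cos_neg, Real.sin_neg]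
    simp only [referenceOrbit, PiLp.inner_apply, Fin.sum_univ_two, ← hη, ← hy]
    apply Complex.ext <;> simp [hK, hc] <;> ring
  have hnorm : ‖cplx y + Complex.I * cplx η‖ ^ 2 = ‖K‖ ^ 2 := by
    have : cplx y + Complex.I * cplx η = Complex.I * K := by
      rw [hK, cplx, cplx]
      apply Complex.ext <;> simp <;> ring
    rw [this, norm_mul, Complex.norm_I, one_mul]
  have h := (integral_exp_circle (c * starRingEnd ℂ K) (c * K)).tsum_eq
  simp only [hwave]
  rw [← h, hnorm, tsum_mul_right, besselSeries, Complex.ofReal_tsum, mul_comm]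
  congr 1
  refine tsum_congr fun j => ?_
  have e : c * starRingEnd ℂ K * (c * K) = ((-(Real.pi ^ 2 * E * ‖K‖ ^ 2) : ℝ) : ℂ) := by
    have h1 : starRingEnd ℂ K * K = ((‖K‖ ^ 2 : ℝ) : ℂ) := by
      rw [Complex.conj_mul']; push_cast; rfl
    have h2 : c * c = ((-(Real.pi ^ 2 * E) : ℝ) : ℂ) := by
      have h3 : (√E : ℂ) * √E = E := by
        rw [← Complex.ofReal_mul, Real.mul_self_sqrt hE.le]
      rw [hc]
      push_cast
      linear_combination (Real.pi : ℂ) ^ 2 * (√E : ℂ) ^ 2 * Complex.I_sq -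
        (Real.pi : ℂ) ^ 2 * h3
    calc _ = (c * c) * (starRingEnd ℂ K * K) := by ring
      _ = _ := by rw [h1, h2]; push_cast; ring
  rw [e]
  push_cast
  rfl

/-! ### The limit of the characteristic functions -/

/-- Since ħ = E/(N+1), the Laguerre argument is a fixed number divided by N+1, precisely the
Mehler–Heine scale. -/
theorem wignerChar_referenceStateFun {E : ℝ} (hE : 0 < E) (N : ℕ) (u : EPhase) :
    wignerChar (planck E N) (referenceStateFun E N) u =
      (Real.exp (-(Real.pi ^ 2 * (‖u.ofLp.2‖ ^ 2 + ‖u.ofLp.1‖ ^ 2)) * planck E N) *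
        laguerre N (Real.pi ^ 2 * E * ‖cplx u.ofLp.2 + Complex.I * cplx u.ofLp.1‖ ^ 2 /
          (N + 1)) : ℝ) := by
  have hh := planck_pos hE N
  rw [wignerChar, ambig_referenceStateFun hE]
  have e1 : cplx ((Real.pi * planck E N) • u.ofLp.2) + (planck E N / 2 : ℝ) * Complex.I *
      cplx ((2 * Real.pi) • u.ofLp.1) =
      ((Real.pi * planck E N : ℝ) : ℂ) * (cplx u.ofLp.2 + Complex.I * cplx u.ofLp.1) := by
    rw [cplx_smul, cplx_smul]
    push_cast
    ring
  rw [e1, norm_mul, Complex.norm_real, norm_smul, norm_smul,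
    Real.norm_of_nonneg (by positivity : 0 ≤ Real.pi * planck E N),
    Real.norm_of_nonneg (by positivity : 0 ≤ 2 * Real.pi)]
  congr 3
  · field_simp
    ring
  · rw [planck]
    field_simp

theorem tendsto_planck (E : ℝ) : Tendsto (planck E) atTop (𝓝 0) := by
  have h := tendsto_one_div_add_atTop_nhds_zero_nat (𝕜 := ℝ)
  have h2 := h.const_mul E
  rw [mul_zero] at h2
  refine h2.congr fun N => ?_
  rw [planck, mul_one_div]

theorem tendsto_wignerChar_referenceStateFun {E : ℝ} (hE : 0 < E) (u : EPhase) :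
    Tendsto (fun N => wignerChar (planck E N) (referenceStateFun E N) u) atTop
      (𝓝 (1 / (2 * Real.pi) * ∫ t in (0 : ℝ)..(2 * Real.pi),
        wave (inner ℝ u (WithLp.toLp 2 (referenceOrbit E t))))) := by
  rw [integral_wave_referenceOrbit hE]
  have hpi : (Real.pi : ℂ) ≠ 0 := by exact_mod_cast Real.pi_ne_zero
  rw [← mul_assoc, one_div_mul_cancel (by simp [hpi]), one_mul]
  simp only [wignerChar_referenceStateFun hE]
  refine (Complex.continuous_ofReal.tendsto _).comp ?_
  have h1 := ((tendsto_planck E).const_mul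
    (-(Real.pi ^ 2 * (‖u.ofLp.2‖ ^ 2 + ‖u.ofLp.1‖ ^ 2)))).rexp
  rw [mul_zero, Real.exp_zero] at h1
  simpa using h1.mul (tendsto_laguerre_div (Real.pi ^ 2 * E *
    ‖cplx u.ofLp.2 + Complex.I * cplx u.ofLp.1‖ ^ 2))

theorem stronglyMeasurable_referenceStateFun (E : ℝ) (N : ℕ) :
    StronglyMeasurable (referenceStateFun E N) := by
  refine Continuous.stronglyMeasurable ?_
  unfold referenceStateFun
  fun_prop

/-- The L² mass is the ambiguity function at the origin, where the closed form gives L_N(0) = 1. -/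
theorem integral_norm_sq_referenceStateFun {E : ℝ} (hE : 0 < E) (N : ℕ) :
    ∫ x, ‖referenceStateFun E N x‖ ^ 2 = 1 := by
  have h := ambig_referenceStateFun hE N 0 0
  have hz : cplx 0 = 0 := by simp [cplx]
  have hl : laguerre N 0 = 1 := by
    rw [laguerre, Finset.sum_range_succ']
    simp
  simp only [ambig, add_zero, sub_zero, inner_zero_left, Complex.ofReal_zero, zero_mul,
    Complex.exp_zero, mul_one, hz, mul_zero, norm_zero] at h
  norm_num [hl] at h
  have h2 : ∫ x, ((‖referenceStateFun E N x‖ ^ 2 : ℝ) : ℂ) = 1 := by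
    rw [← h]
    refine integral_congr_ae (Eventually.of_forall fun x => ?_)
    simp only [Complex.mul_conj, Complex.normSq_eq_norm_sq]
  have h3 : ∫ x, ((‖referenceStateFun E N x‖ ^ 2 : ℝ) : ℂ) = _ := integral_ofReal
  exact Complex.ofReal_injective (h3.symm.trans (h2.trans Complex.ofReal_one.symm))

/-- Weak convergence of the Wigner distributions of the reference states against Schwartz
symbols. -/
theorem tendsto_integral_schwartz_mul_wigner {E : ℝ} (hE : 0 < E) (g : 𝓢(EPhase, ℂ)) :
    Tendsto (fun N => ∫ w : PhaseSpace, g (WithLp.toLp 2 w) *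
        wigner (planck E N) (referenceStateFun E N) w) atTop
      (𝓝 (1 / (2 * Real.pi) * ∫ t in (0 : ℝ)..(2 * Real.pi),
        g (WithLp.toLp 2 (referenceOrbit E t)))) := by
  set b : 𝓢(EPhase, ℂ) := 𝓕 g with hb
  have h1 : ∀ N, ∫ w : PhaseSpace, g (WithLp.toLp 2 w) *
      wigner (planck E N) (referenceStateFun E N) w =
      ∫ u, b u * wignerChar (planck E N) (referenceStateFun E N) u := fun N =>
    integral_schwartz_mul_wigner (planck_pos hE N) (stronglyMeasurable_referenceStateFun E N)
      (memLp_referenceStateFun hE N) g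
  have hcont : Continuous fun t => (WithLp.toLp 2 (referenceOrbit E t) : EPhase) := by
    refine (WithLp.prod_continuous_toLp 2 Plane Plane).comp ?_
    unfold referenceOrbit
    fun_prop
  -- The limit functional is recognized by Fubini and Fourier inversion of g at the points of the
  -- orbit.
  have h2 : ∫ u, b u * (1 / (2 * Real.pi) * ∫ t in (0 : ℝ)..(2 * Real.pi),
      wave (inner ℝ u (WithLp.toLp 2 (referenceOrbit E t)))) =
      1 / (2 * Real.pi) * ∫ t in (0 : ℝ)..(2 * Real.pi),
        g (WithLp.toLp 2 (referenceOrbit E t)) := by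
    simp only [intervalIntegral.integral_of_le Real.two_pi_pos.le]
    have hint : Integrable (Function.uncurry fun (u : EPhase) (t : ℝ) =>
        wave (inner ℝ u (WithLp.toLp 2 (referenceOrbit E t))) * b u)
        (volume.prod (volume.restrict (Set.Ioc 0 (2 * Real.pi)))) := by
      have h3 := b.integrable.mul_prod (μ := volume) (ν := volume.restrict
        (Set.Ioc 0 (2 * Real.pi))) (integrable_const (1 : ℂ))
      simp only [mul_one] at h3
      refine h3.bdd_mul (c := 1) ?_ (Eventually.of_forall fun z => (norm_wave _).le)
      exact (continuous_wave.comp (continuous_fst.inner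
        (hcont.comp continuous_snd))).aestronglyMeasurable
    have h4 := integral_integral_swap hint
    have h5 : ∀ t, g (WithLp.toLp 2 (referenceOrbit E t)) =
        ∫ u, wave (inner ℝ u (WithLp.toLp 2 (referenceOrbit E t))) * b u :=
      fun t => schwartz_eq_integral_wave g _
    simp only [h5]
    rw [← h4, ← integral_const_mul]
    refine integral_congr_ae (Eventually.of_forall fun u => ?_)
    simp only [integral_mul_const]
    ring
  simp only [h1]
  rw [← h2]
  refine tendsto_integral_of_dominated_convergence (fun u => ‖b u‖) (fun N => ?_)
    b.integrable.norm (fun N => Eventually.of_forall fun u => ?_)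
    (Eventually.of_forall fun u => (tendsto_wignerChar_referenceStateFun hE u).const_mul (b u))
  · exact b.continuous.aestronglyMeasurable.mul (stronglyMeasurable_wignerChar _
      (stronglyMeasurable_referenceStateFun E N)).aestronglyMeasurable
  · have := norm_ambig_le (stronglyMeasurable_referenceStateFun E N)
      (memLp_referenceStateFun hE N) ((Real.pi * planck E N) • u.ofLp.2)
      ((2 * Real.pi) • u.ofLp.1)
    rw [integral_norm_sq_referenceStateFun hE] at this
    rw [norm_mul]
    exact mul_le_of_le_one_right (norm_nonneg _) this

theorem quasiMeasurePreserving_affine (x : Plane) {r : ℝ} (hr : r ≠ 0) :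
    Measure.QuasiMeasurePreserving (fun v : Plane => x + r • v) := by
  have h : Measure.QuasiMeasurePreserving (fun v : Plane => r • v) := by
    refine ⟨by fun_prop, ?_⟩
    rw [Measure.map_addHaar_smul volume hr]
    exact Measure.smul_absolutelyContinuous
  exact (measurePreserving_add_left volume x).quasiMeasurePreserving.comp h

theorem wigner_congr_ae (ħ : ℝ) {f f' : Plane → ℂ} (h : f =ᵐ[volume] f') :
    wigner ħ f = wigner ħ f' := by
  ext w
  rw [wigner_eq, wigner_eq]
  congr 1
  refine integral_congr_ae ?_
  have h1 := (quasiMeasurePreserving_affine w.1 (r := 1 / 2) (by norm_num)).ae_eq_comp h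
  have h2 := (quasiMeasurePreserving_affine w.1 (r := -(1 / 2)) (by norm_num)).ae_eq_comp h
  filter_upwards [h1, h2] with v hv1 hv2
  simp only [Function.comp_apply, neg_smul, ← sub_eq_add_neg] at hv1 hv2
  rw [corr, corr, hv1, hv2]

/-! ### Convergence for the reference orbit -/

theorem norm_referenceOrbit {E : ℝ} (hE : 0 < E) (t : ℝ) : ‖referenceOrbit E t‖ = √E := by
  have h1 : ‖(referenceOrbit E t).1‖ = √E := by
    rw [EuclideanSpace.norm_eq]
    congr 1
    simp only [referenceOrbit, Fin.sum_univ_two, Real.norm_eq_abs, sq_abs]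
    simp only [Matrix.cons_val_zero, Matrix.cons_val_one, mul_pow,
      Real.sq_sqrt hE.le]
    rw [← mul_add, Real.cos_sq_add_sin_sq, mul_one]
  have h2 : ‖(referenceOrbit E t).2‖ = √E := by
    rw [EuclideanSpace.norm_eq]
    congr 1
    simp only [referenceOrbit, Fin.sum_univ_two, Real.norm_eq_abs, sq_abs]
    simp only [Matrix.cons_val_zero, Matrix.cons_val_one, mul_pow, neg_sq,
      Real.sq_sqrt hE.le]
    rw [← mul_add, Real.sin_sq_add_cos_sq, mul_one]
  rw [Prod.norm_def, h1, h2, max_self]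

/-- Weak convergence of the Wigner distributions of the reference states. -/
theorem tendsto_integral_mul_wigner_reference {E : ℝ} (hE : 0 < E) {a : PhaseSpace → ℝ}
    (ha : ContDiff ℝ ∞ a) (hai : Integrable a) :
    Tendsto (fun N => ∫ w : PhaseSpace, (a w : ℂ) *
        wigner (planck E N) (referenceStateFun E N) w) atTop
      (𝓝 (((1 / (2 * Real.pi)) * ∫ t in (0 : ℝ)..(2 * Real.pi), a (referenceOrbit E t) : ℝ) :
        ℂ)) := by
  obtain ⟨δ, hδ, htail⟩ := exists_wigner_referenceStateFun_tail hE
  have hR : 0 < 2 * √E := by positivity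
  -- The ball is for the sup norm of the product. It contains the orbit, of sup norm √E, and outside
  -- it |x|² + |ξ|² ≥ 4E, so the tail bound applies.
  let χ : ContDiffBump (0 : PhaseSpace) := ⟨2 * √E, 2 * √E + 1, hR, by linarith⟩
  have hχ1 : ∀ w : PhaseSpace, ‖w‖ ≤ 2 * √E → χ w = 1 := fun w hw =>
    χ.one_of_mem_closedBall (by simpa using hw)
  have hcd : ContDiff ℝ ∞ (fun u : EPhase => ((χ u.ofLp * a u.ofLp : ℝ) : ℂ)) :=
    Complex.ofRealCLM.contDiff.comp ((χ.contDiff.mul ha).comp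
      (WithLp.prodContinuousLinearEquiv 2 ℝ Plane Plane).contDiff)
  have hcs : HasCompactSupport (fun u : EPhase => ((χ u.ofLp * a u.ofLp : ℝ) : ℂ)) := by
    have h0 : HasCompactSupport (fun w => χ w * a w) := χ.hasCompactSupport.mul_right
    have h1 : HasCompactSupport (fun u : EPhase => χ u.ofLp * a u.ofLp) :=
      h0.comp_homeomorph (WithLp.prodContinuousLinearEquiv 2 ℝ Plane Plane).toHomeomorph
    exact h1.comp_left (g := fun r : ℝ => (r : ℂ)) Complex.ofReal_zero
  set g : 𝓢(EPhase, ℂ) := hcs.toSchwartzMap hcd with hgdef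
  have hg : ∀ w : PhaseSpace, g (WithLp.toLp 2 w) = ((χ w * a w : ℝ) : ℂ) := fun w => rfl
  have hlim := tendsto_integral_schwartz_mul_wigner hE g
  have hgo : ∀ t, g (WithLp.toLp 2 (referenceOrbit E t)) = (a (referenceOrbit E t) : ℂ) := by
    intro t
    rw [hg, hχ1 _ (by rw [norm_referenceOrbit hE]; linarith [Real.sqrt_nonneg E]), one_mul]
  simp only [hgo, intervalIntegral.integral_ofReal] at hlim
  have hai' : Integrable (fun w => (a w : ℂ)) := hai.ofReal
  have hgi : Integrable (fun w : PhaseSpace => g (WithLp.toLp 2 w)) :=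
    integrable_comp_toLp g.integrable
  have hrest : Tendsto (fun N => ∫ w : PhaseSpace, ((a w : ℂ) - g (WithLp.toLp 2 w)) *
      wigner (planck E N) (referenceStateFun E N) w) atTop (𝓝 0) := by
    refine squeeze_zero_norm (a := fun N => δ N * ∫ w, |a w|) (fun N => ?_) ?_
    · rw [← integral_const_mul]
      refine norm_integral_le_of_norm_le (hai.abs.const_mul _) (Eventually.of_forall fun w => ?_)
      have hδ0 : 0 ≤ δ N := by
        -- Any point in the tail region shows δ N ≥ 0; this one has |x|² = 8E.
        refine (norm_nonneg _).trans (htail N (WithLp.toLp 2 fun _ => 2 * √E, 0) ?_)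
        rw [EuclideanSpace.norm_sq_eq]
        simp [mul_pow, Real.sq_sqrt hE.le]
        linarith
      by_cases hw : ‖w‖ ≤ 2 * √E
      · rw [hg, hχ1 w hw, one_mul, sub_self, zero_mul, norm_zero]
        positivity
      · have h4 : 4 * E ≤ ‖w.1‖ ^ 2 + ‖w.2‖ ^ 2 := by
          have h5 : (2 * √E) ^ 2 = 4 * E := by rw [mul_pow, Real.sq_sqrt hE.le]; norm_num
          rw [Prod.norm_def, max_le_iff, not_and_or, not_le, not_le] at hw
          rw [← h5]
          rcases hw with hw | hw
          · nlinarith [sq_nonneg ‖w.2‖]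
          · nlinarith [sq_nonneg ‖w.1‖]
        rw [norm_mul, mul_comm]
        refine mul_le_mul (htail N w h4) ?_ (norm_nonneg _) hδ0
        rw [hg, ← Complex.ofReal_sub, Complex.norm_real, Real.norm_eq_abs,
          show a w - χ w * a w = (1 - χ w) * a w by ring, abs_mul]
        refine mul_le_of_le_one_left (abs_nonneg _) ?_
        rw [abs_of_nonneg (by linarith [χ.le_one (x := w)])]
        linarith [χ.nonneg (x := w)]
    · simpa using hδ.mul_const (∫ w, |a w|)
  have hsum := hlim.add hrest
  rw [add_zero] at hsum
  convert! hsum using 1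
  · ext N
    have hm := stronglyMeasurable_referenceStateFun E N
    have hm2 := memLp_referenceStateFun hE N
    have h3 := integral_add (integrable_mul_wigner (planck E N) hm hm2 hgi)
      (integrable_mul_wigner (planck E N) hm hm2 (hai'.sub hgi))
    refine Eq.trans ?_ h3
    refine integral_congr_ae (Eventually.of_forall fun w => ?_)
    simp only [Pi.sub_apply]
    ring
  · push_cast
    rfl

/-! ### Invariance under the stabilizer of the reference orbit -/

/-- In the coordinates z = x + iξ the Wigner function depends only on |z| and |z₁ - iz₂|, the
modulus of the Hermitian product of z with (1, i), the direction of the orbit. -/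
theorem wigner_referenceStateFun {E : ℝ} (hE : 0 < E) (N : ℕ) (w : PhaseSpace) :
    wigner (planck E N) (referenceStateFun E N) w =
      (((-1) ^ N / (Real.pi * planck E N) ^ 2 : ℝ) : ℂ) *
        (Real.exp (-‖(WithLp.toLp 2 w : EPhase)‖ ^ 2 / planck E N) *
          laguerre N (‖zCoord w 0 - Complex.I * zCoord w 1‖ ^ 2 / planck E N) : ℝ) := by
  have hh := planck_pos hE N
  rw [wigner_eq_ambig_of_parity hh (referenceStateFun_neg E N), ambig_referenceStateFun hE]
  set ħ := planck E N
  have e1 : cplx w.1 + (ħ / 2 : ℝ) * Complex.I * cplx (-(2 / ħ) • w.2) =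
      starRingEnd ℂ (zCoord w 0 - Complex.I * zCoord w 1) := by
    have e : (ħ / 2 : ℝ) * Complex.I * cplx (-(2 / ħ) • w.2) = -(Complex.I * cplx w.2) := by
      have : (ħ : ℂ) ≠ 0 := by exact_mod_cast hh.ne'
      rw [cplx_smul]; push_cast; field_simp
    rw [e]
    apply Complex.ext <;> simp [cplx, zCoord] <;> ring
  rw [e1, RCLike.norm_conj, WithLp.prod_norm_sq_eq_of_L2, norm_smul, norm_neg,
    Real.norm_of_nonneg (by positivity : 0 ≤ 2 / ħ)]
  congr 4
  simp only [WithLp.toLp_fst, WithLp.toLp_snd]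
  field_simp
  ring

theorem zCoord_referenceOrbit (E t : ℝ) :
    zCoord (referenceOrbit E t) =
      ((√E : ℂ) * Complex.exp (-(t * Complex.I))) • ![1, Complex.I] := by
  rw [← neg_mul, ← Complex.ofReal_neg, Complex.exp_mul_I, ← Complex.ofReal_cos,
    ← Complex.ofReal_sin, Real.cos_neg, Real.sin_neg]
  ext k
  fin_cases k <;> apply Complex.ext <;> simp [zCoord, referenceOrbit]

/-- The hypothesis makes (1, i) an eigenvector of S with unimodular eigenvalue, hence also of S*. So
S preserves both |z| and the modulus of the product with (1, i). -/
theorem wigner_referenceStateFun_matrixAct {E : ℝ} (hE : 0 < E) (N : ℕ)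
    {S : Matrix (Fin 2) (Fin 2) ℂ} (hS : S ∈ Matrix.unitaryGroup (Fin 2) ℂ) {s : ℝ}
    (hs : matrixAct S (referenceOrbit E 0) = referenceOrbit E s) (w : PhaseSpace) :
    wigner (planck E N) (referenceStateFun E N) (matrixAct S w) =
      wigner (planck E N) (referenceStateFun E N) w := by
  rw [wigner_referenceStateFun hE, wigner_referenceStateFun hE, norm_matrixAct hS]
  have hsq : (√E : ℂ) ≠ 0 := by exact_mod_cast (Real.sqrt_pos.2 hE).ne'
  have h1 : S.mulVec ![1, Complex.I] = Complex.exp (-(s * Complex.I)) • ![1, Complex.I] := by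
    have h := congrArg zCoord hs
    rw [zCoord_matrixAct, zCoord_referenceOrbit, zCoord_referenceOrbit, Matrix.mulVec_smul,
      Complex.ofReal_zero, zero_mul, neg_zero, Complex.exp_zero, mul_one, mul_smul] at h
    exact smul_right_injective _ hsq h
  have h2 : S.conjTranspose.mulVec ![1, Complex.I] =
      Complex.exp (s * Complex.I) • ![1, Complex.I] := by
    have h3 := congrArg (fun v => Complex.exp (s * Complex.I) • S.conjTranspose.mulVec v) h1
    have h4 : S.conjTranspose * S = 1 := (Matrix.mem_unitaryGroup_iff').1 hS
    simp only [Matrix.mulVec_mulVec, h4, Matrix.one_mulVec, Matrix.mulVec_smul, smul_smul,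
      ← Complex.exp_add, add_neg_cancel, Complex.exp_zero, one_smul] at h3
    exact h3.symm
  have h5 : ∀ z : Fin 2 → ℂ, z 0 - Complex.I * z 1 = star ![1, Complex.I] ⬝ᵥ z := by
    intro z
    simp [dotProduct, Fin.sum_univ_two]
    ring
  have h6 : ‖zCoord (matrixAct S w) 0 - Complex.I * zCoord (matrixAct S w) 1‖ =
      ‖zCoord w 0 - Complex.I * zCoord w 1‖ := by
    rw [h5, h5, zCoord_matrixAct, Matrix.dotProduct_mulVec]
    have h7 : Matrix.vecMul (star ![1, Complex.I]) S =
        star (S.conjTranspose.mulVec ![1, Complex.I]) := by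
      rw [Matrix.star_mulVec, Matrix.conjTranspose_conjTranspose]
    rw [h7, h2, star_smul, smul_dotProduct, smul_eq_mul, norm_mul, norm_star,
      Complex.norm_exp_ofReal_mul_I, one_mul]
  rw [h6]

/-! ### Hamiltonian orbits -/

/-- The Hamiltonian flow `z ↦ exp (-it) z`. -/
def hamiltonFlow (t : ℝ) (w : PhaseSpace) : PhaseSpace := Real.cos t • w - Real.sin t • rotate w

/-- In the rotating frame the orbit has zero derivative, hence is constant; undoing the rotation
gives the flow. -/
theorem IsHamiltonianOrbit.eq_flow {γ : ℝ → PhaseSpace} (h : IsHamiltonianOrbit γ) (t : ℝ) :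
    γ t = hamiltonFlow t (γ 0) := by
  have h1 : ∀ t, HasDerivAt (fun t => (γ t).1) (γ t).2 t := fun t =>
    (ContinuousLinearMap.fst ℝ Plane Plane).hasFDerivAt.comp_hasDerivAt t (h t)
  have h2 : ∀ t, HasDerivAt (fun t => (γ t).2) (-(γ t).1) t := fun t =>
    (ContinuousLinearMap.snd ℝ Plane Plane).hasFDerivAt.comp_hasDerivAt t (h t)
  have hA : ∀ t, HasDerivAt (fun t => Real.cos t • (γ t).1 - Real.sin t • (γ t).2) 0 t := by
    intro t
    convert! ((Real.hasDerivAt_cos t).smul (h1 t)).sub ((Real.hasDerivAt_sin t).smul (h2 t)) using 1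
    module
  have hB : ∀ t, HasDerivAt (fun t => Real.sin t • (γ t).1 + Real.cos t • (γ t).2) 0 t := by
    intro t
    convert! ((Real.hasDerivAt_sin t).smul (h1 t)).add ((Real.hasDerivAt_cos t).smul (h2 t)) using 1
    module
  have cA := is_const_of_deriv_eq_zero (fun t => (hA t).differentiableAt)
    (fun t => (hA t).deriv) t 0
  have cB := is_const_of_deriv_eq_zero (fun t => (hB t).differentiableAt)
    (fun t => (hB t).deriv) t 0
  simp only [Real.cos_zero, Real.sin_zero, one_smul, zero_smul, sub_zero, zero_add] at cA cB
  have hcs := Real.cos_sq_add_sin_sq t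
  refine Prod.ext ?_ ?_
  · simp only [hamiltonFlow, rotate, Prod.fst_sub, Prod.smul_fst, ← cA, ← cB]
    calc (γ t).1 = (Real.cos t ^ 2 + Real.sin t ^ 2) • (γ t).1 := by rw [hcs, one_smul]
      _ = _ := by module
  · simp only [hamiltonFlow, rotate, Prod.snd_sub, Prod.smul_snd, ← cA, ← cB]
    calc (γ t).2 = (Real.cos t ^ 2 + Real.sin t ^ 2) • (γ t).2 := by rw [hcs, one_smul]
      _ = _ := by module

theorem zCoord_sub (w w' : PhaseSpace) : zCoord (w - w') = zCoord w - zCoord w' := by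
  ext k; simp [zCoord]; ring

theorem zCoord_hamiltonFlow (t : ℝ) (w : PhaseSpace) :
    zCoord (hamiltonFlow t w) = Complex.exp (-(t * Complex.I)) • zCoord w := by
  rw [hamiltonFlow, zCoord_sub, zCoord_smul, zCoord_smul, zCoord_rotate, ← neg_mul,
    ← Complex.ofReal_neg, Complex.exp_mul_I, ← Complex.ofReal_cos, ← Complex.ofReal_sin,
    Real.cos_neg, Real.sin_neg, smul_smul, ← sub_smul]
  congr 1
  push_cast
  ring

theorem hamiltonFlow_matrixAct (U : Matrix (Fin 2) (Fin 2) ℂ) (t : ℝ) (w : PhaseSpace) :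
    hamiltonFlow t (matrixAct U w) = matrixAct U (hamiltonFlow t w) := by
  apply zCoord_injective
  rw [zCoord_hamiltonFlow, zCoord_matrixAct, zCoord_matrixAct, zCoord_hamiltonFlow,
    Matrix.mulVec_smul]

theorem hamiltonFlow_referenceOrbit (E t s : ℝ) :
    hamiltonFlow t (referenceOrbit E s) = referenceOrbit E (t + s) := by
  apply zCoord_injective
  rw [zCoord_hamiltonFlow, zCoord_referenceOrbit, zCoord_referenceOrbit, smul_smul,
    mul_left_comm, ← Complex.exp_add]
  congr 3
  push_cast
  ring

/-- The time average over an orbit is the time average over the transported reference orbit. -/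
theorem integral_orbit_eq {E : ℝ} {γ : ℝ → PhaseSpace} (hγ : IsHamiltonianOrbit γ)
    {U : Matrix (Fin 2) (Fin 2) ℂ}
    (hU : matrixAct U '' Set.range (referenceOrbit E) = Set.range γ) (a : PhaseSpace → ℝ) :
    ∫ t in (0 : ℝ)..(2 * Real.pi), a (γ t) =
      ∫ t in (0 : ℝ)..(2 * Real.pi), a (matrixAct U (referenceOrbit E t)) := by
  obtain ⟨_, ⟨s, rfl⟩, hs⟩ : γ 0 ∈ matrixAct U '' Set.range (referenceOrbit E) := by
    rw [hU]; exact ⟨0, rfl⟩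
  have h1 : ∀ t, γ t = matrixAct U (referenceOrbit E (t + s)) := by
    intro t
    rw [hγ.eq_flow t, ← hs, hamiltonFlow_matrixAct, hamiltonFlow_referenceOrbit]
  have hper : Function.Periodic (fun t => a (matrixAct U (referenceOrbit E t))) (2 * Real.pi) := by
    intro t
    simp [referenceOrbit, Real.cos_add_two_pi, Real.sin_add_two_pi]
  simp only [h1]
  -- Equality of orbits as sets leaves an unknown time shift s, absorbed by 2π-periodicity.
  rw [intervalIntegral.integral_comp_add_right (fun t => a (matrixAct U (referenceOrbit E t))),
    zero_add, add_comm]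
  have := hper.intervalIntegral_add_eq s 0
  rwa [zero_add] at this

/-! ### The main theorem -/

theorem matrixAct_mul (A B : Matrix (Fin 2) (Fin 2) ℂ) (w : PhaseSpace) :
    matrixAct (A * B) w = matrixAct A (matrixAct B w) := by
  apply zCoord_injective
  rw [zCoord_matrixAct, zCoord_matrixAct, zCoord_matrixAct, Matrix.mulVec_mulVec]

theorem matrixAct_one (w : PhaseSpace) : matrixAct 1 w = w := by
  apply zCoord_injective
  rw [zCoord_matrixAct, Matrix.one_mulVec]

/-- The matrix element against an orbital coherent state is expressed by the reference state,
with the same unitary matrix for all `N`. -/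
theorem IsOrbitalCoherentState.integral_mul_wigner {E : ℝ} {hE : 0 < E} {γ : ℝ → PhaseSpace}
    {N : ℕ} {φ : L2Plane} (hφ : IsOrbitalCoherentState hE γ N φ)
    {U : Matrix (Fin 2) (Fin 2) ℂ} (hU : U ∈ Matrix.unitaryGroup (Fin 2) ℂ)
    (hUγ : matrixAct U '' Set.range (referenceOrbit E) = Set.range γ) (a : PhaseSpace → ℂ) :
    ∫ w, a w * wigner (planck E N) φ w =
      ∫ w, a (matrixAct U w) * wigner (planck E N) (referenceStateFun E N) w := by
  obtain ⟨V, hV, hVγ, T, hT, rfl⟩ := hφ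
  have hV' := (Matrix.mem_specialUnitaryGroup_iff.1 hV).1
  rw [integral_mul_wigner_metaplectic (planck_pos hE N) hV' hT,
    show wigner (planck E N) (referenceState hE N) = wigner (planck E N) (referenceStateFun E N) from
      wigner_congr_ae (planck E N) (memLp_referenceStateFun hE N).coeFn_toLp]
  -- V is the matrix belonging to this N and U the fixed one; U*V sends the start of the reference
  -- orbit to another of its points, so it leaves the reference Wigner function invariant.
  have hS : U.conjTranspose * V ∈ Matrix.unitaryGroup (Fin 2) ℂ :=
    mul_mem (Unitary.star_mem hU) hV'
  have hU1 : U.conjTranspose * U = 1 := (Matrix.mem_unitaryGroup_iff').1 hU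
  have hU2 : U * U.conjTranspose = 1 := (Matrix.mem_unitaryGroup_iff).1 hU
  obtain ⟨_, ⟨s, rfl⟩, hs⟩ :
      matrixAct V (referenceOrbit E 0) ∈ matrixAct U '' Set.range (referenceOrbit E) := by
    rw [hUγ, ← hVγ]
    exact ⟨_, ⟨0, rfl⟩, rfl⟩
  have hfix : matrixAct (U.conjTranspose * V) (referenceOrbit E 0) = referenceOrbit E s := by
    rw [matrixAct_mul, ← hs, ← matrixAct_mul, hU1, matrixAct_one]
  rw [← integral_comp_matrixAct hS (fun w => a (matrixAct U w) *
    wigner (planck E N) (referenceStateFun E N) w)]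
  refine integral_congr_ae (Eventually.of_forall fun w => ?_)
  simp only
  rw [wigner_referenceStateFun_matrixAct hE N hS hfix, ← matrixAct_mul, ← mul_assoc, hU2, one_mul]

theorem contDiff_matrixAct {U : Matrix (Fin 2) (Fin 2) ℂ}
    (hU : U ∈ Matrix.unitaryGroup (Fin 2) ℂ) : ContDiff ℝ ∞ (matrixAct U) :=
  (WithLp.prodContinuousLinearEquiv 2 ℝ Plane Plane).contDiff.comp
    ((unitaryAct U hU).toContinuousLinearEquiv.contDiff.comp
      (WithLp.prodContinuousLinearEquiv 2 ℝ Plane Plane).symm.contDiff)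

theorem integrable_comp_matrixAct {U : Matrix (Fin 2) (Fin 2) ℂ}
    (hU : U ∈ Matrix.unitaryGroup (Fin 2) ℂ) {a : PhaseSpace → ℝ} (ha : Integrable a) :
    Integrable (fun w => a (matrixAct U w)) :=
  (measurePreserving_of_isometry (unitaryAct U hU)).integrable_comp_of_integrable ha

end OrbitalCoherent

end

open OrbitalCoherent in
theorem proposition1p1 (E : ℝ) (hE : 0 < E)
    (γ : ℝ → PhaseSpace) (hγ : IsHamiltonianOrbit γ) (hγE : ∀ t : ℝ, hamiltonian (γ t) = E)
    (φ : ℕ → L2Plane) (hφ : ∀ N : ℕ, IsOrbitalCoherentState hE γ N (φ N))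
    (a : PhaseSpace → ℝ) (ha : ContDiff ℝ ∞ a) (hdecay : HasExponentialDecay a) :
    (∀ N : ℕ, Integrable (fun w : PhaseSpace => (a w : ℂ) * wigner (planck E N) (φ N) w)) ∧
    Tendsto (fun N : ℕ => ∫ w : PhaseSpace, (a w : ℂ) * wigner (planck E N) (φ N) w) atTop
      (𝓝 (((1 / (2 * Real.pi)) * ∫ t in (0 : ℝ)..(2 * Real.pi), a (γ t) : ℝ) : ℂ)) ∧
    (∀ N : ℕ, MemLp (weylOp (planck E N) a (φ N)) 2 (volume : Measure Plane)) ∧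
    Tendsto (fun N : ℕ => ∫ x : Plane,
        starRingEnd ℂ ((φ N : Plane → ℂ) x) * weylOp (planck E N) a (φ N) x) atTop
      (𝓝 (((1 / (2 * Real.pi)) * ∫ t in (0 : ℝ)..(2 * Real.pi), a (γ t) : ℝ) : ℂ)) := by
  have hm : Measurable a := ha.continuous.measurable
  have hai : Integrable a := hdecay.integrable hm
  have hlim : Tendsto (fun N : ℕ => ∫ w : PhaseSpace, (a w : ℂ) *
      wigner (planck E N) (φ N) w) atTop
      (𝓝 (((1 / (2 * Real.pi)) * ∫ t in (0 : ℝ)..(2 * Real.pi), a (γ t) : ℝ) : ℂ)) := by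
    -- The matrix of level 0 serves for all levels, so a single transported symbol a ∘ U enters the
    -- limit.
    obtain ⟨U, hU, hUγ, -⟩ := hφ 0
    have hU' := (Matrix.mem_specialUnitaryGroup_iff.1 hU).1
    simp only [fun N => (hφ N).integral_mul_wigner hU' hUγ (fun w => (a w : ℂ))]
    rw [integral_orbit_eq hγ hUγ a]
    exact tendsto_integral_mul_wigner_reference hE (ha.comp (contDiff_matrixAct hU'))
      (integrable_comp_matrixAct hU' hai)
  refine ⟨fun N => integrable_mul_wigner _ (stronglyMeasurable_coe _) (Lp.memLp _) hai.ofReal,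
    hlim, fun N => memLp_weylOp _ (stronglyMeasurable_coe _) (Lp.memLp _) hm hdecay, ?_⟩
  simpa only [fun N => integral_conj_mul_weylOp (planck E N) (stronglyMeasurable_coe (φ N))
    (Lp.memLp (φ N)) hai] using hlim
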